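/- **Criterion of basic embeddability of graphs in the plane.** A subset $S\subset\mathbb R^2$ is called *basic* if for every continuous function $f:S\to\mathbb R$ there are continuous functions $g,h:\mathbb R\to\mathbb R$ such that $f(x,y)=g(x)+h(y)$ for every $(x,y)\in S$. A space $K$ is *basically embeddable* in the plane if there is a topological embedding $K\to\mathbb R^2$ whose image is basic. Finite graphs are regarded as topological spaces (geometric realizations), not necessarily connected, and their subgraphs are taken up to subdivision. Let $T_k$ be the star with $k$ rays ($T_3$ is the triod, $T_4$ the cross, $T_5$ the pentode). *Branching* a hanging edge means attaching two new edges at its end of degree one. Let $C$ be the cross with branched ends, i.e. the graph obtained from $T_4$ by branching each of its four edges. Let $F_1=T_3$, and for $n\ge1$ let $F_{n+1}$ be obtained from $F_n$ by branching every hanging edge of $F_n$. For $n\ge 1$ let $R_n$ be obtained from $F_n$ by attaching one new hanging edge at every branching point (vertex of degree at least $3$) of $F_n$. **Theorem.** For every finite graph $K$ the following three conditions are equivalent: 1. $K$ is basically embeddable in the plane; 2. (S) $K$ contains no subgraph homeomorphic to the circle $S^1$, to the pentode $T_5$, or to the cross with branched ends $C$; 3. (U) there is an $n\ge1$ such that $K$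 is contained in $R_n$, i.e. there is a topological embedding $K\to R_n$. -/

import Mathlib

open Topology

namespace BasicEmbedding

/-! ### Basic subsets of the plane -/

/-- A subset `S` of the plane is basic if every continuous `f : S → ℝ` is of the form
`f (x, y) = g x + h y` on `S`, with `g, h : ℝ → ℝ` continuous. -/
def IsBasic (S : Set (ℝ × ℝ)) : Prop :=
  ∀ f : S → ℝ, Continuous f →
    ∃ g h : ℝ → ℝ, Continuous g ∧ Continuous h ∧
      ∀ p : S, f p = g (p : ℝ × ℝ).1 + h (p : ℝ × ℝ).2

/-- `K` is basically embeddable in the plane: there is a topological embedding of `K` into the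
plane whose image is basic. -/
def BasicallyEmbeddable (K : Type*) [TopologicalSpace K] : Prop :=
  ∃ φ : K → ℝ × ℝ, IsEmbedding φ ∧ IsBasic (Set.range φ)

/-! ### Finite graphs as topological spaces -/

open Classical in
/-- The point of `ℝ^V` representing the vertex `v`: the basis vector with index `v`. -/
noncomputable def vertexPoint {V : Type*} (v : V) : V → ℝ := Pi.single v 1

/-- The part of `ℝ^V` occupied by a subgraph `H` of a graph on `V`: the points of the vertices
of `H` and the straight segments joining the end points of the edges of `H`. -/
def carrier {V : Type*} {G : SimpleGraph V} (H : G.Subgraph) : Set (V → ℝ) :=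
  {x | ∃ v ∈ H.verts, x = vertexPoint v} ∪
    {x | ∃ u v, H.Adj u v ∧ x ∈ segment ℝ (vertexPoint u) (vertexPoint v)}

/-- The geometric realization of a graph, with the topology induced from `ℝ^V`
(used for finite `V` only). -/
abbrev Realization {V : Type*} (G : SimpleGraph V) : Type _ :=
  ↥(carrier (⊤ : G.Subgraph))

/-- A topological space is a finite graph if it is homeomorphic to the realization of a finite
simple graph. (Loops and multiple edges are covered too: subdividing each edge into three
edges makes the combinatorial graph simple and does not change the space.) -/
def IsFiniteGraph (K : Type*) [TopologicalSpace K] : Prop :=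
  ∃ (n : ℕ) (G : SimpleGraph (Fin n)), Nonempty (K ≃ₜ Realization G)

/-- A subset `L` of a finite graph `K` is a subgraph if, for some presentation of `K` as the
realization of a finite simple graph `G`, it is the part occupied by a subgraph of `G`. -/
def IsSubgraph {K : Type*} [TopologicalSpace K] (L : Set K) : Prop :=
  ∃ (n : ℕ) (G : SimpleGraph (Fin n)) (e : K ≃ₜ Realization G) (H : G.Subgraph),
    L = {x : K | (e x : Fin n → ℝ) ∈ carrier H}

/-- `K` contains a subgraph homeomorphic to `X`. -/
def HasSubgraphHomeomorphicTo (K X : Type*) [TopologicalSpace K] [TopologicalSpace X] : Prop :=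
  ∃ L : Set K, IsSubgraph L ∧ Nonempty (L ≃ₜ X)

/-- `K` is contained in `Y` (as a topological space). -/
def IsContainedIn (K Y : Type*) [TopologicalSpace K] [TopologicalSpace Y] : Prop :=
  ∃ i : K → Y, IsEmbedding i

/-! ### The particular graphs -/

/-- The graph obtained from `G` by attaching, at each vertex `v`, `p v` new hanging edges
(each of them with a new vertex of degree one at its other end). -/
def attachGraph {V : Type} (G : SimpleGraph V) (p : V → ℕ) :
    SimpleGraph (V ⊕ (Σ v : V, Fin (p v))) where
  Adj x y :=
    match x, y with
    | .inl u, .inl v => G.Adj u v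
    | .inl u, .inr w => u = w.1
    | .inr w, .inl u => u = w.1
    | .inr _, .inr _ => False
  symm := by
    constructor
    rintro (u | w) (v | z) h
    · exact SimpleGraph.Adj.symm (G := G) h
    · exact h
    · exact h
    · exact h
  loopless := by
    constructor
    rintro (u | w) h
    · exact G.loopless.irrefl u h
    · exact h

/-- A finite simple graph together with its vertex set. -/
structure FinGraph where
  V : Type
  fin : Finite V
  graph : SimpleGraph V

namespace FinGraph

/-- The topological space of a finite graph. -/
abbrev Space (A : FinGraph) : Type := Realization A.graph

/-- The degree of a vertex. -/
noncomputable def deg (A : FinGraph) (v : A.V) : ℕ := (A.graph.neighborSet v).ncard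

/-- `attachGraph` for bundled graphs. -/
abbrev attach (A : FinGraph) (p : A.V → ℕ) : FinGraph where
  V := A.V ⊕ (Σ v : A.V, Fin (p v))
  fin := by
    have := A.fin
    infer_instance
  graph := attachGraph A.graph p

/-- The one-vertex graph. -/
abbrev point : FinGraph where
  V := Unit
  fin := inferInstance
  graph := ⊥

/-- The star `T_k` with `k` rays: `T_3` is the triod, `T_4` the cross, `T_5` the pentode. -/
abbrev starGraph (k : ℕ) : FinGraph := point.attach fun _ => k

open Classical in
/-- Branching of all hanging edges: two new edges are attached at every vertex of degree one. -/
noncomputable def branch (A : FinGraph) : FinGraph :=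
  A.attach fun v => if A.deg v = 1 then 2 else 0

/-- The cross with branched ends `C`. -/
noncomputable def crossBranched : FinGraph := (starGraph 4).branch

/-- The graphs `F_n` for `n ≥ 1`: `F_1` is the triod, and `F_{n+1}` is obtained from `F_n` by
branching every hanging edge. (The value at `0` is not used.) -/
noncomputable def F : ℕ → FinGraph
  | 0 => point
  | 1 => starGraph 3
  | n + 2 => (F (n + 1)).branch

open Classical in
/-- The graph `R_n`, for `n ≥ 1`: a hanging edge is added to `F_n` at every branching point, that
is, at every vertex of degree at least three. -/
noncomputable def R (n : ℕ) : FinGraph :=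
  (F n).attach fun v => if 3 ≤ (F n).deg v then 1 else 0

end FinGraph

end BasicEmbedding

namespace BasicEmbedding

/-! ### Realizations -/

section Realization

variable {V W : Type*}

/-! Regard each point of a plane set as an edge joining the vertical and the horizontal line through
it (`incidence`). To write `f` as `g x + h y` is to prescribe the increments of a potential along
these edges. Since a cycle imposes a linear relation on `f`, the incidence graph of a basic set is a
forest. If the set is compact, the open mapping theorem bounds `g` and `h` in terms of `f`, and
alternating signs along a path then bound its length (`IsBasic.exists_length_le`). Hence arbitrarily
long zigzags are impossible (`IsBasic.false_of_walks`).

On a circle no point disconnects, so all but finitely many points have partners on both of their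
lines, and this can be iterated. For curves leaving a connected family of lines, each germ leaves a
box through some of its four sides. If in some family every side used by a germ is also used by
another germ, the intermediate value theorem produces endless zigzags; so in every family some germ
owns a side. Counting gives at most four germs, and at most three if each leaves in both directions
(`IsBasic.card_germs_le`). This excludes the pentode. For `C`, take the component of the centre in
the incidence graph of the central cross: either a ray stays in it to its end, and five germs leave,
or four rays leave in both directions.

A graph without the three subgraphs is, after suppression of vertices of degree two, a forest with
degrees at most four in which each vertex of degree four has a leaf as neighbour. With one such leaf
detached at each of them, the forest has degrees at most three and sits in some `F n`; the leaves go
to the hanging edges of `R n` (`exists_hom_R`).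

Finally, a compact basic set stays basic when a graph over one coordinate is added, provided that
the set already contains the points of the graph over its projection (`IsBasic.union_graph`). A
self-similar drawing of the binary tree with hanging edges is assembled in this way, and every `R n`
embeds in it. -/

lemma vertexPoint_apply [DecidableEq V] (v w : V) :
    vertexPoint v w = if w = v then (1 : ℝ) else 0 := by
  classical
  simp [vertexPoint, Pi.single_apply]

lemma vertexPoint_self (v : V) : vertexPoint v v = 1 := by
  classical
  simp [vertexPoint_apply]

lemma vertexPoint_of_ne {v w : V} (h : w ≠ v) : vertexPoint v w = 0 := by
  classical
  simp [vertexPoint_apply, h]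

/-- The point dividing the segment from the vertex `u` to the vertex `v` in the ratio
`t : 1 - t`. -/
noncomputable def edgePoint (u v : V) (t : ℝ) : V → ℝ :=
  (1 - t) • vertexPoint u + t • vertexPoint v

lemma edgePoint_zero (u v : V) : edgePoint u v 0 = vertexPoint u := by simp [edgePoint]

lemma edgePoint_one (u v : V) : edgePoint u v 1 = vertexPoint v := by simp [edgePoint]

lemma edgePoint_symm (u v : V) (t : ℝ) : edgePoint u v (1 - t) = edgePoint v u t := by
  simp [edgePoint, add_comm]

lemma edgePoint_apply_left {u v : V} (h : u ≠ v) (t : ℝ) : edgePoint u v t u = 1 - t := by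
  simp [edgePoint, vertexPoint_self, vertexPoint_of_ne h]

lemma edgePoint_apply_right {u v : V} (h : u ≠ v) (t : ℝ) : edgePoint u v t v = t := by
  simp [edgePoint, vertexPoint_self, vertexPoint_of_ne h.symm]

lemma edgePoint_apply_of_ne {u v w : V} (hu : w ≠ u) (hv : w ≠ v) (t : ℝ) :
    edgePoint u v t w = 0 := by
  simp [edgePoint, vertexPoint_of_ne hu, vertexPoint_of_ne hv]

lemma continuous_edgePoint (u v : V) : Continuous (edgePoint u v) := by
  unfold edgePoint
  fun_prop

lemma mem_segment_vertexPoint {u v : V} {x : V → ℝ} :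
    x ∈ segment ℝ (vertexPoint u) (vertexPoint v) ↔
      ∃ t ∈ Set.Icc (0 : ℝ) 1, edgePoint u v t = x := by
  rw [segment_eq_image]
  rfl

lemma mem_carrier_iff {G : SimpleGraph V} {H : G.Subgraph} {x : V → ℝ} :
    x ∈ carrier H ↔ (∃ v ∈ H.verts, x = vertexPoint v) ∨
      ∃ u v, H.Adj u v ∧ ∃ t ∈ Set.Icc (0 : ℝ) 1, edgePoint u v t = x := by
  simp only [carrier, Set.mem_union, Set.mem_ofPred_eq, mem_segment_vertexPoint]

lemma edgePoint_mem_carrier {G : SimpleGraph V} {H : G.Subgraph} {u v : V} (h : H.Adj u v)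
    {t : ℝ} (ht : t ∈ Set.Icc (0 : ℝ) 1) : edgePoint u v t ∈ carrier H :=
  mem_carrier_iff.2 (Or.inr ⟨u, v, h, t, ht, rfl⟩)

lemma vertexPoint_mem_carrier {G : SimpleGraph V} {H : G.Subgraph} {v : V} (h : v ∈ H.verts) :
    vertexPoint v ∈ carrier H :=
  mem_carrier_iff.2 (Or.inl ⟨v, h, rfl⟩)

lemma isCompact_carrier [Finite V] {G : SimpleGraph V} (H : G.Subgraph) :
    IsCompact (carrier H) := by
  have : carrier H = (⋃ v ∈ H.verts, {vertexPoint v}) ∪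
      ⋃ p ∈ {p : V × V | H.Adj p.1 p.2}, edgePoint p.1 p.2 '' Set.Icc (0 : ℝ) 1 := by
    ext x
    simp [mem_carrier_iff]
  rw [this]
  refine IsCompact.union ?_ ?_
  · exact (Set.toFinite _).isCompact_biUnion fun v _ => isCompact_singleton
  · exact (Set.toFinite _).isCompact_biUnion fun p _ =>
      isCompact_Icc.image (continuous_edgePoint _ _)

instance [Finite V] (G : SimpleGraph V) : CompactSpace (Realization G) :=
  isCompact_iff_compactSpace.1 (isCompact_carrier _)

/-- Extension by zero along a map of vertex sets. -/
noncomputable abbrev pushPoint (f : V → W) : (V → ℝ) →ₗ[ℝ] (W → ℝ) :=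
  Function.ExtendByZero.linearMap ℝ f

lemma pushPoint_apply {f : V → W} (hf : Function.Injective f) (x : V → ℝ) (v : V) :
    pushPoint f x (f v) = x v := by
  simp [pushPoint, hf.extend_apply]

lemma pushPoint_vertexPoint {f : V → W} (hf : Function.Injective f) (v : V) :
    pushPoint f (vertexPoint v) = vertexPoint (f v) := by
  classical
  ext w
  by_cases hw : ∃ u, f u = w
  · obtain ⟨u, rfl⟩ := hw
    rw [pushPoint_apply hf]
    simp [vertexPoint_apply, hf.eq_iff]
  · have : pushPoint f (vertexPoint v) w = 0 := by
      simp [pushPoint, Function.extend_apply' _ _ _ hw]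
    rw [this, vertexPoint_of_ne]
    rintro rfl
    exact hw ⟨v, rfl⟩

lemma pushPoint_edgePoint {f : V → W} (hf : Function.Injective f) (u v : V) (t : ℝ) :
    pushPoint f (edgePoint u v t) = edgePoint (f u) (f v) t := by
  simp only [edgePoint, map_add, map_smul, pushPoint_vertexPoint hf]

lemma continuous_pushPoint {f : V → W} (hf : Function.Injective f) :
    Continuous (pushPoint f) := by
  refine continuous_pi fun w => ?_
  by_cases hw : ∃ u, f u = w
  · obtain ⟨u, rfl⟩ := hw
    simp only [pushPoint_apply hf]
    exact continuous_apply u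
  · have : ∀ x, pushPoint f x w = 0 := fun x => by
      simp [pushPoint, Function.extend_apply' _ _ _ hw]
    simp only [this]
    exact continuous_const

lemma pushPoint_image_carrier {G : SimpleGraph V} {G' : SimpleGraph W} (f : G →g G')
    (hf : Function.Injective f) :
    pushPoint f '' carrier (⊤ : G.Subgraph) = carrier ((⊤ : G.Subgraph).map f) := by
  ext y
  constructor
  · rintro ⟨x, hx, rfl⟩
    rcases mem_carrier_iff.1 hx with ⟨v, -, rfl⟩ | ⟨u, v, h, t, ht, rfl⟩
    · rw [pushPoint_vertexPoint hf]
      exact vertexPoint_mem_carrier ⟨v, trivial, rfl⟩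
    · rw [pushPoint_edgePoint hf]
      exact edgePoint_mem_carrier (H := (⊤ : G.Subgraph).map f) ⟨u, v, h, rfl, rfl⟩ ht
  · intro hy
    rcases mem_carrier_iff.1 hy with ⟨_, ⟨v, -, rfl⟩, rfl⟩ | ⟨_, _, ⟨u, v, h, rfl, rfl⟩, t, ht, rfl⟩
    · exact ⟨_, vertexPoint_mem_carrier (v := v) trivial, pushPoint_vertexPoint hf v⟩
    · exact ⟨_, edgePoint_mem_carrier (H := ⊤) h ht, pushPoint_edgePoint hf u v t⟩

lemma carrier_mono {G : SimpleGraph V} {H H' : G.Subgraph} (h : H ≤ H') :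
    carrier H ⊆ carrier H' := by
  intro x hx
  rcases mem_carrier_iff.1 hx with ⟨v, hv, rfl⟩ | ⟨u, v, h', t, ht, rfl⟩
  · exact vertexPoint_mem_carrier (h.1 hv)
  · exact edgePoint_mem_carrier (h.2 h') ht

/-- The map of realizations induced by an injective homomorphism. -/
noncomputable def realizationMap {G : SimpleGraph V} {G' : SimpleGraph W} (f : G →g G')
    (hf : Function.Injective f) (x : Realization G) : Realization G' :=
  ⟨pushPoint f x, carrier_mono le_top
    (pushPoint_image_carrier f hf ▸ Set.mem_image_of_mem _ x.2)⟩

lemma isEmbedding_realizationMap {G : SimpleGraph V} {G' : SimpleGraph W} (f : G →g G')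
    (hf : Function.Injective f) : IsEmbedding (realizationMap f hf) := by
  have h1 : Continuous (pushPoint f) := continuous_pushPoint hf
  have h2 : IsEmbedding (pushPoint f) := by
    refine IsEmbedding.of_leftInverse (f := fun y v => y (f v)) ?_ (by fun_prop) h1
    intro x
    ext v
    exact pushPoint_apply hf x v
  exact IsEmbedding.of_comp
    (Continuous.subtype_mk (h1.comp continuous_subtype_val) _) continuous_subtype_val
    (h2.comp IsEmbedding.subtypeVal)

lemma range_realizationMap {G : SimpleGraph V} {G' : SimpleGraph W} (f : G →g G')
    (hf : Function.Injective f) :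
    Set.range (realizationMap f hf) =
      {x : Realization G' | (x : W → ℝ) ∈ carrier ((⊤ : G.Subgraph).map f)} := by
  ext x
  rw [Set.mem_ofPred_eq, ← pushPoint_image_carrier f hf]
  constructor
  · rintro ⟨y, rfl⟩
    exact ⟨y, y.2, rfl⟩
  · rintro ⟨y, hy, h⟩
    exact ⟨⟨y, hy⟩, Subtype.ext h⟩

/-- Isomorphic graphs have homeomorphic realizations. -/
noncomputable def realizationCongr {G : SimpleGraph V} {G' : SimpleGraph W} (f : G ≃g G') :
    Realization G ≃ₜ Realization G' :=
  (isEmbedding_realizationMap f.toHom f.injective).toHomeomorphOfSurjective (by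
    rw [← Set.range_eq_univ, range_realizationMap]
    refine Set.eq_univ_of_forall fun x => ?_
    have : (⊤ : G.Subgraph).map f.toHom = ⊤ := by
      ext u v
      · simp
      · constructor
        · exact fun h => h.adj_sub
        · intro h
          refine ⟨f.symm u, f.symm v, ?_, f.apply_symm_apply u, f.apply_symm_apply v⟩
          exact f.symm.map_adj_iff.2 h
    rw [Set.mem_ofPred_eq, this]
    exact x.2)

/-- The image subgraph need not be induced, so an injective homomorphism suffices. All three
forbidden subgraphs are found through this. -/
lemma hasSubgraph_of_hom {K : Type*} [TopologicalSpace K] {n : ℕ} {G : SimpleGraph (Fin n)}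
    (e : K ≃ₜ Realization G) {X : Type*} [TopologicalSpace X] {A : SimpleGraph V}
    (hX : Realization A ≃ₜ X) (f : A →g G) (hf : Function.Injective f) :
    HasSubgraphHomeomorphicTo K X := by
  have he : IsEmbedding (e.symm ∘ realizationMap f hf) :=
    e.symm.isEmbedding.comp (isEmbedding_realizationMap f hf)
  refine ⟨_, ⟨n, G, e, (⊤ : A.Subgraph).map f, rfl⟩, ⟨?_⟩⟩
  refine (Homeomorph.setCongr ?_).trans (he.toHomeomorph.symm.trans hX)
  rw [Set.range_comp, range_realizationMap]
  ext x
  constructor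
  · intro hx
    exact ⟨e x, hx, by simp⟩
  · rintro ⟨y, hy, rfl⟩
    simpa using hy

end Realization

/-! ### The realization of a cycle -/

section Cycle

variable (m : ℕ)

lemma fin_ne_add_one (i : Fin (m + 3)) : i ≠ i + 1 := by
  intro h
  have := congrArg Fin.val h
  rw [Fin.val_add, Fin.val_one] at this
  have hi := i.2
  rcases Nat.lt_or_ge (i.val + 1) (m + 3) with h1 | h1
  · rw [Nat.mod_eq_of_lt h1] at this
    omega
  · have : i.val + 1 = m + 3 := by omega
    simp_all

lemma fin_ne_add_two (i : Fin (m + 3)) : i ≠ i + 1 + 1 := by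
  intro h
  rw [add_assoc] at h
  have h0 : (1 + 1 : Fin (m + 3)) = 0 := by
    have : i + 0 = i + (1 + 1) := by simpa using h
    exact (add_left_cancel this).symm
  have := congrArg Fin.val h0
  rw [Fin.val_add, Fin.val_one, Nat.mod_eq_of_lt (by omega)] at this
  simp at this

lemma one_le_norm_addCircle {T : ℝ} (x : ℝ) (h : ∀ k : ℤ, 1 ≤ |x - k * T|) :
    1 ≤ ‖(x : AddCircle T)‖ := by
  rw [AddCircle.norm_eq]
  exact h _

/-- The `j`-th barycentric coordinate of a point of the circle of length `m + 3`, subdivided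
into arcs of length one. -/
noncomputable def cyclePoint (θ : AddCircle ((m + 3 : ℕ) : ℝ)) : Fin (m + 3) → ℝ :=
  fun j => max 0 (1 - ‖θ - ((j : ℕ) : ℝ)‖)

lemma continuous_cyclePoint : Continuous (cyclePoint m) := by
  unfold cyclePoint
  fun_prop

/-- The tents have radius one and the circle has length at least three, so on an arc only the tents
centred at its two ends can be nonzero. -/
lemma cyclePoint_coe (i : Fin (m + 3)) {t : ℝ} (ht : t ∈ Set.Icc (0 : ℝ) 1) :
    cyclePoint m (((i : ℕ) + t : ℝ)) = edgePoint i (i + 1) t := by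
  have hT : (3 : ℝ) ≤ ((m + 3 : ℕ) : ℝ) := by push_cast; linarith [Nat.cast_nonneg (α := ℝ) m]
  have hT0 : ((m + 3 : ℕ) : ℝ) ≠ 0 := by linarith
  have hn := fin_ne_add_one m i
  -- The integer `q` is one at the last vertex, where the numbering wraps around, and zero
  -- elsewhere.
  obtain ⟨q, hq⟩ : ∃ q : ℤ, ((i + 1 : Fin (m + 3)) : ℕ) = (i : ℤ) + 1 - (m + 3 : ℕ) * q := by
    refine ⟨((i : ℤ) + 1) / (m + 3 : ℕ), ?_⟩
    rw [Fin.val_add, Fin.val_one]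
    push_cast
    rw [← Int.emod_def]
  ext j
  simp only [cyclePoint]
  rw [← AddCircle.coe_sub]
  by_cases h1 : j = i
  · subst h1
    rw [edgePoint_apply_left hn, add_sub_cancel_left,
      (AddCircle.norm_coe_eq_abs_iff _ hT0).2, abs_of_nonneg ht.1, max_eq_right]
    · linarith [ht.2]
    · rw [abs_of_nonneg ht.1, abs_of_pos (by linarith)]
      linarith [ht.2]
  by_cases h2 : j = i + 1
  · subst h2
    rw [edgePoint_apply_right hn]
    have hq' : (((i + 1 : Fin (m + 3)) : ℕ) : ℝ) = (i : ℕ) + 1 - ((m + 3 : ℕ) : ℝ) * q := by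
      exact_mod_cast hq
    have : (((i : ℕ) + t - ((i + 1 : Fin (m + 3)) : ℕ) : ℝ) : AddCircle ((m + 3 : ℕ) : ℝ)) =
        ((t - 1 : ℝ) : AddCircle ((m + 3 : ℕ) : ℝ)) := by
      rw [← sub_eq_zero, ← AddCircle.coe_sub, AddCircle.coe_eq_zero_iff]
      refine ⟨q, ?_⟩
      rw [hq', zsmul_eq_mul]
      ring
    have habs : |t - 1| = 1 - t := by rw [abs_of_nonpos (by linarith [ht.2])]; ring
    rw [this, (AddCircle.norm_coe_eq_abs_iff _ hT0).2, habs, max_eq_right]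
    · ring
    · linarith [ht.1]
    · rw [habs, abs_of_pos (by linarith)]
      linarith [ht.1]
  · rw [edgePoint_apply_of_ne h1 h2, max_eq_left]
    rw [sub_nonpos]
    refine one_le_norm_addCircle _ fun k => ?_
    by_contra hlt
    push Not at hlt
    have h3 := abs_lt.1 hlt
    -- If the tent at `j` were nonzero here, this integer would be `0` or `-1`, so that `j` would be
    -- `i` or `i + 1`.
    set c : ℤ := (i : ℤ) - j - k * (m + 3 : ℕ) with hc
    have hcr : (c : ℝ) = (i : ℕ) - (j : ℕ) - k * ((m + 3 : ℕ) : ℝ) := by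
      rw [hc]; push_cast; ring
    have h4 : (c : ℝ) < 1 := by rw [hcr]; linarith [ht.1]
    have h5 : (-2 : ℝ) < c := by rw [hcr]; linarith [ht.2]
    have h6 : c < 1 := by exact_mod_cast h4
    have h7 : -2 < c := by exact_mod_cast h5
    have hj := j.2
    have hi := i.2
    have hi' := (i + 1).2
    have key : ∀ a b : ℤ, 0 ≤ a → a < (m + 3 : ℕ) → 0 ≤ b → b < (m + 3 : ℕ) →
        (∃ r : ℤ, a - b = (m + 3 : ℕ) * r) → a = b := by
      rintro a b ha ha' hb hb' ⟨r, hr⟩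
      have : a ≡ b [ZMOD (m + 3 : ℕ)] := (Int.modEq_of_dvd ⟨r, hr⟩).symm
      rwa [Int.ModEq, Int.emod_eq_of_lt ha ha', Int.emod_eq_of_lt hb hb'] at this
    rcases (by omega : c = 0 ∨ c = -1) with h0 | h0
    · apply h1
      have := key j i (by omega) (by omega) (by omega) (by omega)
        ⟨-k, by rw [hc] at h0; linear_combination -h0⟩
      exact Fin.ext (by omega)
    · apply h2
      have := key j ((i + 1 : Fin (m + 3)) : ℕ) (by omega) (by omega) (by positivity)
        (by exact_mod_cast hi')
        ⟨q - k, by rw [hc] at h0; linear_combination -h0 - hq⟩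
      exact Fin.ext (by omega)

lemma exists_eq_coe_addCircle (θ : AddCircle ((m + 3 : ℕ) : ℝ)) :
    ∃ i : Fin (m + 3), ∃ t ∈ Set.Ico (0 : ℝ) 1, θ = (((i : ℕ) + t : ℝ)) := by
  have : Fact (0 < ((m + 3 : ℕ) : ℝ)) := ⟨by positivity⟩
  obtain ⟨⟨t, ht⟩, rfl⟩ := (AddCircle.equivIco ((m + 3 : ℕ) : ℝ) 0).symm.surjective θ
  rw [zero_add] at ht
  refine ⟨⟨⌊t⌋₊, (Nat.floor_lt ht.1).2 ht.2⟩, t - ⌊t⌋₊,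
    ⟨sub_nonneg.2 (Nat.floor_le ht.1), by linarith [Nat.lt_floor_add_one t]⟩, ?_⟩
  rw [add_sub_cancel]
  rfl

lemma edgePoint_succ_injective {i j : Fin (m + 3)} {s t : ℝ} (hs : s ∈ Set.Ico (0 : ℝ) 1)
    (ht : t ∈ Set.Ico (0 : ℝ) 1) (h : edgePoint i (i + 1) s = edgePoint j (j + 1) t) :
    i = j ∧ s = t := by
  have hi := fin_ne_add_one m i
  have hj := fin_ne_add_one m j
  by_cases hij : i = j
  · subst hij
    have := congrFun h (i + 1)
    rw [edgePoint_apply_right hi, edgePoint_apply_right hi] at this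
    exact ⟨rfl, this⟩
  exfalso
  have h1 : i = j + 1 := by
    by_contra h1
    have := congrFun h i
    rw [edgePoint_apply_left hi, edgePoint_apply_of_ne hij h1] at this
    linarith [hs.2]
  have h2 : j = i + 1 := by
    by_contra h1
    have := congrFun h j
    rw [edgePoint_apply_left hj, edgePoint_apply_of_ne (Ne.symm hij) h1] at this
    linarith [ht.2]
  rw [h1] at h2
  exact fin_ne_add_two m j h2

lemma range_cyclePoint :
    Set.range (cyclePoint m) = carrier (⊤ : (SimpleGraph.cycleGraph (m + 3)).Subgraph) := by
  have hadj : ∀ i : Fin (m + 3), (⊤ : (SimpleGraph.cycleGraph (m + 3)).Subgraph).Adj i (i + 1) := by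
    intro i
    rw [SimpleGraph.Subgraph.top_adj, SimpleGraph.cycleGraph_adj]
    simp
  ext x
  constructor
  · rintro ⟨θ, rfl⟩
    obtain ⟨i, t, ht, rfl⟩ := exists_eq_coe_addCircle m θ
    rw [cyclePoint_coe m i ⟨ht.1, ht.2.le⟩]
    exact edgePoint_mem_carrier (hadj i) ⟨ht.1, ht.2.le⟩
  · intro hx
    rcases mem_carrier_iff.1 hx with ⟨v, -, rfl⟩ | ⟨u, v, h, t, ht, rfl⟩
    · exact ⟨_, (cyclePoint_coe m v (t := 0) (by simp)).trans (edgePoint_zero _ _)⟩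
    · rw [SimpleGraph.Subgraph.top_adj, SimpleGraph.cycleGraph_adj] at h
      rcases h with h | h
      · obtain rfl : u = v + 1 := by rw [← h]; abel
        rw [← edgePoint_symm]
        exact ⟨_, cyclePoint_coe m v (t := 1 - t) ⟨by linarith [ht.2], by linarith [ht.1]⟩⟩
      · obtain rfl : v = u + 1 := by rw [← h]; abel
        exact ⟨_, cyclePoint_coe m u ht⟩

/-- The realization of a cycle is a circle. -/
lemma nonempty_realization_cycleGraph_homeomorph :
    Nonempty (Realization (SimpleGraph.cycleGraph (m + 3)) ≃ₜ Circle) := by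
  have : Fact (0 < ((m + 3 : ℕ) : ℝ)) := ⟨by positivity⟩
  have hinj : Function.Injective (cyclePoint m) := by
    intro θ θ' h
    obtain ⟨i, t, ht, rfl⟩ := exists_eq_coe_addCircle m θ
    obtain ⟨j, s, hs, rfl⟩ := exists_eq_coe_addCircle m θ'
    rw [cyclePoint_coe m i ⟨ht.1, ht.2.le⟩, cyclePoint_coe m j ⟨hs.1, hs.2.le⟩] at h
    obtain ⟨rfl, rfl⟩ := edgePoint_succ_injective m ht hs h
    rfl
  have he := ((continuous_cyclePoint m).isClosedEmbedding hinj).isEmbedding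
  exact ⟨((Homeomorph.setCongr (range_cyclePoint m)).symm.trans he.toHomeomorph.symm).trans
    (AddCircle.homeomorphCircle (by positivity))⟩

lemma isAcyclic_of_not_hasSubgraph_circle {K : Type*} [TopologicalSpace K] {n : ℕ}
    {G : SimpleGraph (Fin n)} (e : K ≃ₜ Realization G)
    (h : ¬ HasSubgraphHomeomorphicTo K Circle) : G.IsAcyclic := by
  rw [SimpleGraph.isAcyclic_iff_free_cycleGraph]
  intro k hk hcopy
  obtain ⟨m, rfl⟩ := Nat.exists_eq_add_of_le' hk
  obtain ⟨f⟩ := hcopy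
  obtain ⟨hc⟩ := nonempty_realization_cycleGraph_homeomorph m
  exact h (hasSubgraph_of_hom e hc f.toHom f.injective)

end Cycle

/-! ### Suppressing a vertex of degree two -/

section Suppress

variable {V : Type*} [DecidableEq V]

/-- The graph obtained from `G` by deleting the vertex `v` and joining `a` to `b`. -/
def suppress (G : SimpleGraph V) (v a b : V) (hab : a ≠ b) : SimpleGraph {w // w ≠ v} where
  Adj p q := G.Adj p q ∨ ((p : V) = a ∧ (q : V) = b) ∨ ((p : V) = b ∧ (q : V) = a)
  symm := ⟨fun p q h => by
    rcases h with h | h | h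
    · exact Or.inl h.symm
    · exact Or.inr (Or.inr ⟨h.2, h.1⟩)
    · exact Or.inr (Or.inl ⟨h.2, h.1⟩)⟩
  loopless := ⟨fun p h => by
    rcases h with h | h | h
    · exact G.loopless.irrefl _ h
    · exact hab (h.1.symm.trans h.2)
    · exact hab (h.2.symm.trans h.1)⟩

variable {v a b : V}

/-- The map of realizations that places the vertex `v` at the midpoint of the edge `ab`. -/
noncomputable def subdividePoint (hav : a ≠ v) (hbv : b ≠ v) (x : {w // w ≠ v} → ℝ) : V → ℝ :=
  fun w => if h : w = v then 2 * min (x ⟨a, hav⟩) (x ⟨b, hbv⟩) else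
    x ⟨w, h⟩ - if w = a ∨ w = b then min (x ⟨a, hav⟩) (x ⟨b, hbv⟩) else 0

lemma continuous_subdividePoint (hav : a ≠ v) (hbv : b ≠ v) :
    Continuous (subdividePoint hav hbv) := by
  refine continuous_pi fun w => ?_
  unfold subdividePoint
  split_ifs <;> fun_prop

/-- The coordinate at `v` determines the minimum that was subtracted from the coordinates at `a` and
`b`. -/
lemma subdividePoint_injective (hav : a ≠ v) (hbv : b ≠ v) :
    Function.Injective (subdividePoint hav hbv) := by
  intro x y h
  have hv := congrFun h v
  simp only [subdividePoint, dif_pos] at hv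
  ext ⟨w, hw⟩
  have hw' := congrFun h w
  simp only [subdividePoint, dif_neg hw] at hw'
  split_ifs at hw' <;> linarith

/-- The hypothesis holds at all points of the realization outside the interior of the edge `ab`. -/
lemma subdividePoint_of_min_eq_zero (hav : a ≠ v) (hbv : b ≠ v) {x : {w // w ≠ v} → ℝ}
    (h : min (x ⟨a, hav⟩) (x ⟨b, hbv⟩) = 0) :
    subdividePoint hav hbv x = pushPoint Subtype.val x := by
  ext w
  by_cases hw : w = v
  · have : ¬ ∃ u : {w // w ≠ v}, (u : V) = w := by
      rintro ⟨u, rfl⟩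
      exact u.2 hw
    simp [subdividePoint, hw, h, pushPoint]
  · have := pushPoint_apply Subtype.val_injective x ⟨w, hw⟩
    simp only at this
    rw [this]
    simp [subdividePoint, hw, h]

lemma subdividePoint_edgePoint (hav : a ≠ v) (hbv : b ≠ v) {p q : {w // w ≠ v}} (hpq : p ≠ q)
    (h : ¬ ((p : V) = a ∧ (q : V) = b)) (h' : ¬ ((p : V) = b ∧ (q : V) = a)) (hab : a ≠ b)
    {t : ℝ} (ht : t ∈ Set.Icc (0 : ℝ) 1) :
    subdividePoint hav hbv (edgePoint p q t) = edgePoint (p : V) (q : V) t := by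
  rw [← pushPoint_edgePoint Subtype.val_injective, subdividePoint_of_min_eq_zero]
  have key : ∀ c : {w // w ≠ v}, 0 ≤ edgePoint p q t c := by
    intro c
    by_cases h1 : c = p
    · subst h1; rw [edgePoint_apply_left hpq]; linarith [ht.2]
    by_cases h2 : c = q
    · subst h2; rw [edgePoint_apply_right hpq]; exact ht.1
    rw [edgePoint_apply_of_ne h1 h2]
  by_cases h1 : (⟨a, hav⟩ : {w // w ≠ v}) ≠ p ∧ (⟨a, hav⟩ : {w // w ≠ v}) ≠ q
  · rw [edgePoint_apply_of_ne h1.1 h1.2]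
    exact min_eq_left (key _)
  · have : (⟨b, hbv⟩ : {w // w ≠ v}) ≠ p ∧ (⟨b, hbv⟩ : {w // w ≠ v}) ≠ q := by
      rw [Ne, Ne, Subtype.ext_iff, Subtype.ext_iff] at h1 ⊢
      simp only at h1 ⊢
      grind
    rw [edgePoint_apply_of_ne this.1 this.2]
    exact min_eq_right (key _)

lemma subdividePoint_left (hav : a ≠ v) (hbv : b ≠ v) (hab : a ≠ b) {t : ℝ}
    (ht : t ≤ 1 / 2) :
    subdividePoint hav hbv (edgePoint ⟨a, hav⟩ ⟨b, hbv⟩ t) = edgePoint a v (2 * t) := by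
  have hab' : (⟨a, hav⟩ : {w // w ≠ v}) ≠ ⟨b, hbv⟩ := fun h => hab (congrArg Subtype.val h)
  have hmin : min (1 - t) t = t := min_eq_right (by linarith)
  ext w
  by_cases hw : w = v
  · subst hw
    simp [subdividePoint, edgePoint_apply_left hab', edgePoint_apply_right hab', hmin,
      edgePoint_apply_right hav]
  simp only [subdividePoint, dif_neg hw, edgePoint_apply_left hab', edgePoint_apply_right hab',
    hmin]
  by_cases hwa : w = a
  · subst hwa
    rw [edgePoint_apply_left hab', edgePoint_apply_left hav]
    simp
    ring
  by_cases hwb : w = b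
  · subst hwb
    rw [edgePoint_apply_right hab', edgePoint_apply_of_ne hwa hw]
    simp
  rw [edgePoint_apply_of_ne (by simpa using hwa) (by simpa using hwb), edgePoint_apply_of_ne hwa hw]
  simp [hwa, hwb]

lemma subdividePoint_right (hav : a ≠ v) (hbv : b ≠ v) (hab : a ≠ b) {t : ℝ}
    (ht : 1 / 2 ≤ t) :
    subdividePoint hav hbv (edgePoint ⟨a, hav⟩ ⟨b, hbv⟩ t) = edgePoint b v (2 * (1 - t)) := by
  rw [← subdividePoint_left hbv hav hab.symm (by linarith), edgePoint_symm]
  ext w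
  simp only [subdividePoint, min_comm, or_comm]

/-- Nonadjacency of `a` and `b` keeps the graph simple: otherwise the new edge would double an old
one. -/
lemma nonempty_realization_suppress {G : SimpleGraph V} [Finite V] (hav : a ≠ v) (hbv : b ≠ v)
    (hab : a ≠ b) (hnadj : ¬ G.Adj a b) (hv : ∀ w, G.Adj v w ↔ w = a ∨ w = b) :
    Nonempty (Realization (suppress G v a b hab) ≃ₜ Realization G) := by
  set G' := suppress G v a b hab
  have hva : G.Adj a v := ((hv a).2 (Or.inl rfl)).symm
  have hvb : G.Adj b v := ((hv b).2 (Or.inr rfl)).symm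
  have hedge : ∀ p q : {w // w ≠ v}, G.Adj p q → ∀ t ∈ Set.Icc (0 : ℝ) 1,
      subdividePoint hav hbv (edgePoint p q t) = edgePoint (p : V) (q : V) t := by
    intro p q h t ht
    refine subdividePoint_edgePoint hav hbv (fun h' => h.ne (congrArg _ h')) ?_ ?_ hab ht
    · rintro ⟨h1, h2⟩
      rw [h1, h2] at h
      exact hnadj h
    · rintro ⟨h1, h2⟩
      rw [h1, h2] at h
      exact hnadj h.symm
  have hvert : ∀ p : {w // w ≠ v},
      subdividePoint hav hbv (vertexPoint p) = vertexPoint (p : V) := by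
    intro p
    rw [subdividePoint_of_min_eq_zero, pushPoint_vertexPoint Subtype.val_injective]
    simp only [vertexPoint_apply]
    split_ifs with h1 h2
    · exact absurd (congrArg Subtype.val (h1.trans h2.symm)) hab
    all_goals simp
  have hnew : ∀ t ∈ Set.Icc (0 : ℝ) 1, subdividePoint hav hbv (edgePoint ⟨a, hav⟩ ⟨b, hbv⟩ t) ∈
      carrier (⊤ : G.Subgraph) := by
    intro t ht
    rcases le_total t (1 / 2) with h | h
    · rw [subdividePoint_left hav hbv hab h]
      exact edgePoint_mem_carrier (H := ⊤) hva ⟨by linarith [ht.1], by linarith⟩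
    · rw [subdividePoint_right hav hbv hab h]
      exact edgePoint_mem_carrier (H := ⊤) hvb ⟨by linarith [ht.2], by linarith⟩
  have himg : subdividePoint hav hbv '' carrier (⊤ : G'.Subgraph) = carrier (⊤ : G.Subgraph) := by
    ext y
    constructor
    · rintro ⟨x, hx, rfl⟩
      rcases mem_carrier_iff.1 hx with ⟨p, -, rfl⟩ | ⟨p, q, h, t, ht, rfl⟩
      · rw [hvert]
        exact vertexPoint_mem_carrier trivial
      · rcases h with h | ⟨h1, h2⟩ | ⟨h1, h2⟩
        · rw [hedge p q h t ht]
          exact edgePoint_mem_carrier (H := ⊤) h ht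
        · obtain rfl : p = ⟨a, hav⟩ := Subtype.ext h1
          obtain rfl : q = ⟨b, hbv⟩ := Subtype.ext h2
          exact hnew t ht
        · obtain rfl : p = ⟨b, hbv⟩ := Subtype.ext h1
          obtain rfl : q = ⟨a, hav⟩ := Subtype.ext h2
          rw [← edgePoint_symm]
          exact hnew (1 - t) ⟨by linarith [ht.2], by linarith [ht.1]⟩
    · have hadj' : (⊤ : G'.Subgraph).Adj ⟨a, hav⟩ ⟨b, hbv⟩ := Or.inr (Or.inl ⟨rfl, rfl⟩)
      have hav' : ∀ t ∈ Set.Icc (0 : ℝ) 1, edgePoint a v t ∈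
          subdividePoint hav hbv '' carrier (⊤ : G'.Subgraph) := by
        intro t ht
        refine ⟨_, edgePoint_mem_carrier hadj' (t := t / 2)
          ⟨by linarith [ht.1], by linarith [ht.2]⟩, ?_⟩
        rw [subdividePoint_left hav hbv hab (by linarith [ht.2])]
        congr 1
        ring
      have hbv' : ∀ t ∈ Set.Icc (0 : ℝ) 1, edgePoint b v t ∈
          subdividePoint hav hbv '' carrier (⊤ : G'.Subgraph) := by
        intro t ht
        refine ⟨_, edgePoint_mem_carrier hadj' (t := 1 - t / 2)
          ⟨by linarith [ht.2], by linarith [ht.1]⟩, ?_⟩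
        rw [subdividePoint_right hav hbv hab (by linarith [ht.2])]
        congr 1
        ring
      have hend : ∀ w, G.Adj w v → ∀ t ∈ Set.Icc (0 : ℝ) 1, edgePoint w v t ∈
          subdividePoint hav hbv '' carrier (⊤ : G'.Subgraph) := by
        intro w hw t ht
        rcases (hv w).1 hw.symm with rfl | rfl
        · exact hav' t ht
        · exact hbv' t ht
      intro hy
      rcases mem_carrier_iff.1 hy with ⟨w, -, rfl⟩ | ⟨p, q, h, t, ht, rfl⟩
      · by_cases hw : w = v
        · subst hw
          rw [← edgePoint_one a w]
          exact hav' 1 (by simp)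
        · exact ⟨_, vertexPoint_mem_carrier (v := ⟨w, hw⟩) trivial, hvert _⟩
      · by_cases hq : q = v
        · subst hq
          exact hend p h t ht
        by_cases hp : p = v
        · subst hp
          rw [← edgePoint_symm]
          exact hend q h.symm (1 - t) ⟨by linarith [ht.2], by linarith [ht.1]⟩
        · exact ⟨_, edgePoint_mem_carrier (H := ⊤) (u := ⟨p, hp⟩) (v := ⟨q, hq⟩) (Or.inl h) ht,
            hedge ⟨p, hp⟩ ⟨q, hq⟩ h t ht⟩
  have hc : Continuous fun x : Realization G' => subdividePoint hav hbv x :=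
    (continuous_subdividePoint hav hbv).comp continuous_subtype_val
  have he := (hc.isClosedEmbedding
    ((subdividePoint_injective hav hbv).comp Subtype.val_injective)).isEmbedding
  refine ⟨he.toHomeomorph.trans (Homeomorph.setCongr ?_)⟩
  rw [← himg, Set.image_eq_range]

end Suppress

/-- A finite graph has a presentation in which every vertex with exactly two neighbours has
adjacent neighbours. -/
lemma IsFiniteGraph.exists_presentation {K : Type*} [TopologicalSpace K] (hK : IsFiniteGraph K) :
    ∃ (n : ℕ) (G : SimpleGraph (Fin n)), Nonempty (K ≃ₜ Realization G) ∧
      ∀ v a b, a ≠ b → (∀ w, G.Adj v w ↔ w = a ∨ w = b) → G.Adj a b := by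
  classical
  -- A presentation with the fewest vertices works, since a vertex violating the condition could be
  -- suppressed.
  obtain ⟨G, ⟨e⟩⟩ := Nat.find_spec hK
  refine ⟨_, G, ⟨e⟩, fun v a b hab hv => ?_⟩
  by_contra hnadj
  have hav : a ≠ v := ((hv a).2 (Or.inl rfl)).ne.symm
  have hbv : b ≠ v := ((hv b).2 (Or.inr rfl)).ne.symm
  obtain ⟨e'⟩ := nonempty_realization_suppress hav hbv hab hnadj hv
  have hcard : Fintype.card {w // w ≠ v} = Nat.find hK - 1 := by simp
  let E := Fintype.equivFinOfCardEq hcard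
  let φ := SimpleGraph.Iso.map E (suppress G v a b hab)
  refine Nat.find_min hK (m := Nat.find hK - 1) (Nat.sub_lt v.pos one_pos)
    ⟨_, ⟨(e.trans e'.symm).trans (realizationCongr φ)⟩⟩

/-! ### Embedding trees into large trees -/

section Trees

variable {V W : Type*}

/-- A rank function on the vertices of a graph: adjacent vertices have different ranks and every
vertex has at most one neighbour of smaller rank. -/
def IsRank (G : SimpleGraph V) (ρ : V → ℕ) : Prop :=
  (∀ u v, G.Adj u v → ρ u ≠ ρ v) ∧
    ∀ u v w, G.Adj u v → G.Adj u w → ρ v < ρ u → ρ w < ρ u → v = w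

lemma IsRank.isAcyclic {G : SimpleGraph V} {ρ : V → ℕ} (h : IsRank G ρ) : G.IsAcyclic := by
  classical
  intro v c hc
  -- A vertex of largest rank on a cycle would have two different neighbours of smaller rank.
  obtain ⟨u, hu, hmax⟩ := c.support.toFinset.exists_max_image ρ ⟨v, by simp⟩
  rw [List.mem_toFinset] at hu
  have hc' := hc.rotate hu
  have h1 := (c.rotate u hu).adj_snd hc'.not_nil
  have h2 := ((c.rotate u hu).adj_penultimate hc'.not_nil).symm
  have key : ∀ w, G.Adj u w → w ∈ (c.rotate u hu).support → ρ w < ρ u := fun w hw hws =>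
    lt_of_le_of_ne (hmax w (by simpa using hws)) (h.1 w u hw.symm)
  refine hc'.snd_ne_penultimate (h.2 u _ _ h1 h2 (key _ h1 ?_) (key _ h2 ?_))
  · exact SimpleGraph.Walk.getVert_mem_support _ _
  · exact SimpleGraph.Walk.getVert_mem_support _ _

/-- In an acyclic graph a vertex outside a connected part has at most one neighbour in it. -/
lemma eq_of_adj_of_adj {S : SimpleGraph V} {H : SimpleGraph W} (hS : S.Preconnected)
    (hH : H.IsAcyclic) (g : S →g H) (hg : Function.Injective g) {z : W} (hz : z ∉ Set.range g)
    {a b : V} (ha : H.Adj z (g a)) (hb : H.Adj z (g b)) : a = b := by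
  classical
  obtain ⟨p⟩ := hS a b
  by_contra hab
  -- Two neighbours would give two paths from `g a` to `g b`, one inside the image and one through
  -- `z`.
  have hp : (p.toPath : S.Walk a b).map g |>.IsPath :=
    p.toPath.2.map hg
  let q : H.Walk (g a) (g b) := .cons ha.symm (.cons hb .nil)
  have hq : q.IsPath := by
    simp only [q, SimpleGraph.Walk.cons_isPath_iff, SimpleGraph.Walk.support_cons,
      SimpleGraph.Walk.support_nil, List.mem_cons, List.not_mem_nil, or_false, not_or,
      SimpleGraph.Walk.IsPath.nil, true_and]
    exact ⟨hb.ne, ha.ne.symm, fun h => hab (hg h)⟩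
  have heq := congrArg Subtype.val ((hH.subsingleton_path _ _).elim ⟨_, hp⟩ ⟨q, hq⟩)
  have : z ∈ ((p.toPath : S.Walk a b).map g).support := by
    simp only at heq
    rw [heq]
    simp [q]
  rw [SimpleGraph.Walk.support_map, List.mem_map] at this
  obtain ⟨x, -, hx⟩ := this
  exact hz ⟨x, hx⟩

/-- A finite tree with all degrees at most three embeds in a member of a sequence of acyclic
graphs, each of which sits in the next one with all its vertices of degree at least three. -/
lemma exists_embedding_of_isTree {W : ℕ → Type*} [Nonempty (W 0)] {H : ∀ i, SimpleGraph (W i)}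
    (ι : ∀ i, H i ↪g H (i + 1)) (hH : ∀ i, (H i).IsAcyclic)
    (hι : ∀ i v, 3 ≤ ((H (i + 1)).neighborSet (ι i v)).encard) (k : ℕ) :
    ∀ {V : Type*} [Finite V] (T : SimpleGraph V), Nat.card V = k → T.IsTree →
      (∀ v, (T.neighborSet v).ncard ≤ 3) → ∃ i, Nonempty (T ↪g H i) := by
  classical
  induction k with
  | zero =>
    intro V _ T hk hT
    have := hT.1.nonempty
    exact absurd hk Nat.card_pos.ne'
  | succ k ih =>
    intro V _ T hk hT hdeg
    rcases subsingleton_or_nontrivial V with hV | hV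
    · obtain ⟨x⟩ := ‹Nonempty (W 0)›
      refine ⟨0, ⟨⟨⟨fun _ => x, fun a b _ => Subsingleton.elim a b⟩, fun {a b} => ?_⟩⟩⟩
      simp [Subsingleton.elim a b]
    -- The rest of the tree is still a tree, so `u` has exactly one neighbour `w`. At the next stage
    -- the image of `w` has degree at least three, of which at most two neighbours are in use.
    obtain ⟨u, hu⟩ := hT.1.exists_connected_induce_compl_singleton_of_finite_nontrivial
    set S := T.induce ({u}ᶜ : Set V) with hS
    have hcard : Nat.card ({u}ᶜ : Set V) = k := by
      have := Set.ncard_add_ncard_compl ({u} : Set V)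
      rw [Set.ncard_singleton, hk] at this
      rw [Nat.card_coe_set_eq]
      omega
    have hSdeg : ∀ v, (S.neighborSet v).ncard ≤ (T.neighborSet (v : V) \ {u}).ncard := by
      intro v
      rw [← Set.ncard_image_of_injective _ Subtype.val_injective]
      refine Set.ncard_le_ncard ?_ (Set.toFinite _)
      rintro _ ⟨w, hw, rfl⟩
      exact ⟨hw, w.2⟩
    obtain ⟨i, ⟨f⟩⟩ := ih S hcard ⟨hu, hT.2.induce _⟩ fun v =>
      (hSdeg v).trans ((Set.ncard_le_ncard Set.sdiff_subset (Set.toFinite _)).trans (hdeg v))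
    obtain ⟨w, huw⟩ : ∃ w, T.Adj u w := hT.1.preconnected.exists_adj_of_nontrivial u
    have hwu : w ∈ ({u}ᶜ : Set V) := huw.ne.symm
    have huniq : ∀ y : ({u}ᶜ : Set V), T.Adj u y → y = ⟨w, hwu⟩ := by
      intro y hy
      refine eq_of_adj_of_adj (z := u) hu.preconnected hT.2
        (SimpleGraph.Embedding.induce _).toHom Subtype.val_injective ?_ hy huw
      rintro ⟨x, hx⟩
      exact x.2 hx
    set g : S ↪g H (i + 1) := (ι i).comp f with hg
    obtain ⟨z, hz, hzn⟩ : ∃ z ∈ (H (i + 1)).neighborSet (g ⟨w, hwu⟩),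
        z ∉ g '' S.neighborSet ⟨w, hwu⟩ := by
      by_contra hcon
      push Not at hcon
      have h1 : ((H (i + 1)).neighborSet (g ⟨w, hwu⟩)).encard ≤
          (g '' S.neighborSet ⟨w, hwu⟩).encard := Set.encard_le_encard hcon
      have h2 : (g '' S.neighborSet ⟨w, hwu⟩).encard ≤ 2 := by
        refine (Set.encard_image_le _ _).trans ?_
        rw [← (Set.toFinite _).cast_ncard_eq]
        have h3 := hSdeg ⟨w, hwu⟩
        have h4 : (T.neighborSet w \ {u}).ncard + 1 = (T.neighborSet w).ncard :=
          Set.ncard_sdiff_singleton_add_one huw.symm (Set.toFinite _)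
        have h5 := hdeg w
        simp only at h3
        exact_mod_cast (by omega : (S.neighborSet ⟨w, hwu⟩).ncard ≤ 2)
      have h3 := ((hι i (f ⟨w, hwu⟩)).trans h1).trans h2
      exact absurd h3 (by decide)
    -- Embeddings reflect adjacency, so a neighbour of the image of `w` inside the image would come
    -- from a neighbour of `w`.
    have hzr : z ∉ Set.range g := by
      rintro ⟨y, rfl⟩
      exact hzn ⟨y, g.map_adj_iff.1 hz, rfl⟩
    have hzadj : ∀ y : ({u}ᶜ : Set V), (H (i + 1)).Adj z (g y) ↔ T.Adj u y := by
      intro y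
      constructor
      · intro h
        rw [eq_of_adj_of_adj hu.preconnected (hH (i + 1)) g.toHom g.injective hzr h hz.symm]
        exact huw
      · intro h
        rw [huniq y h]
        exact hz.symm
    obtain ⟨φ, hφ, hφu⟩ : ∃ φ : V → W (i + 1), (∀ y : ({u}ᶜ : Set V), φ y = g y) ∧ φ u = z :=
      ⟨fun v => if h : v ∈ ({u}ᶜ : Set V) then g ⟨v, h⟩ else z, fun y => dif_pos y.2,
        dif_neg (by simp)⟩
    have hcases : ∀ x, x = u ∨ ∃ y : ({u}ᶜ : Set V), x = y := fun x =>
      (em (x = u)).imp_right fun h => ⟨⟨x, h⟩, rfl⟩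
    refine ⟨i + 1, ⟨⟨⟨φ, fun x y hxy => ?_⟩, fun {x y} => ?_⟩⟩⟩
    · rcases hcases x with rfl | ⟨x, rfl⟩ <;> rcases hcases y with rfl | ⟨y, rfl⟩
      · rfl
      · rw [hφu, hφ] at hxy
        exact absurd ⟨_, hxy.symm⟩ hzr
      · rw [hφu, hφ] at hxy
        exact absurd ⟨_, hxy⟩ hzr
      · rw [hφ, hφ] at hxy
        exact congrArg Subtype.val (g.injective hxy)
    · change (H (i + 1)).Adj (φ x) (φ y) ↔ T.Adj x y
      rcases hcases x with rfl | ⟨x, rfl⟩ <;> rcases hcases y with rfl | ⟨y, rfl⟩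
      · simp
      · rw [hφu, hφ]
        exact hzadj y
      · rw [hφu, hφ, SimpleGraph.adj_comm, T.adj_comm]
        exact hzadj x
      · rw [hφ, hφ]
        exact g.map_adj_iff

/-- In a finite acyclic graph every vertex can be joined to a vertex of degree at most one. -/
lemma exists_reachable_ncard_neighborSet_le_one [Finite V] {G : SimpleGraph V}
    (hG : G.IsAcyclic) (u : V) : ∃ w, G.Reachable u w ∧ (G.neighborSet w).ncard ≤ 1 := by
  classical
  have := Fintype.ofFinite V
  -- All neighbours of the end of a longest path lie on the path, and by acyclicity only the
  -- penultimate vertex is possible.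
  let P : ℕ → Prop := fun k => ∃ w, ∃ p : G.Walk u w, p.IsPath ∧ p.length = k
  have hb : ∀ k, P k → k ≤ Fintype.card V := by
    rintro k ⟨w, p, hp, rfl⟩
    exact hp.length_lt.le
  have hP0 : P 0 := ⟨u, .nil, by simp, rfl⟩
  obtain ⟨w, p, hp, hlen⟩ := Nat.findGreatest_spec (P := P) (Nat.zero_le (Fintype.card V)) hP0
  have hmem : ∀ x, G.Adj w x → x ∈ p.support := by
    intro x hx
    by_contra hxs
    have : P (p.length + 1) := ⟨x, p.concat hx, hp.concat hxs hx, by simp⟩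
    have h2 := Nat.le_findGreatest (hb _ this) this
    omega
  refine ⟨w, ⟨p⟩, ?_⟩
  rw [Set.ncard_le_one_iff (Set.toFinite _)]
  intro x y hx hy
  rw [hG.eq_penultimate_of_adj_end hp hx (hmem x hx),
    hG.eq_penultimate_of_adj_end hp hy (hmem y hy)]

/-- A finite acyclic graph with degrees at most three is a spanning subgraph of such a tree. -/
lemma exists_isTree_ge [Finite V] [Nonempty V] {G : SimpleGraph V} (hG : G.IsAcyclic)
    (hdeg : ∀ v, (G.neighborSet v).ncard ≤ 3) :
    ∃ T : SimpleGraph V, G ≤ T ∧ T.IsTree ∧ ∀ v, (T.neighborSet v).ncard ≤ 3 := by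
  classical
  -- In a maximal such forest there is only one component: two components could be joined at
  -- vertices of degree at most one.
  obtain ⟨T, hGT, hT⟩ := (Set.toFinite {T : SimpleGraph V | T.IsAcyclic ∧
    ∀ v, (T.neighborSet v).ncard ≤ 3}).exists_le_maximal (a := G) ⟨hG, hdeg⟩
  refine ⟨T, hGT, ⟨(SimpleGraph.connected_iff _).2 ⟨fun u v => ?_, inferInstance⟩, hT.1.1⟩, hT.1.2⟩
  by_contra huv
  obtain ⟨u', hu', hdu⟩ := exists_reachable_ncard_neighborSet_le_one hT.1.1 u
  obtain ⟨v', hv', hdv⟩ := exists_reachable_ncard_neighborSet_le_one hT.1.1 v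
  have huv' : ¬ T.Reachable u' v' := fun h => huv ((hu'.trans h).trans hv'.symm)
  have hne : u' ≠ v' := by
    rintro rfl
    exact huv' (SimpleGraph.Reachable.refl _)
  have hadj : (T ⊔ SimpleGraph.edge u' v').Adj u' v' := by
    simp [SimpleGraph.edge_adj, hne]
  have hle : T ⊔ SimpleGraph.edge u' v' ≤ T := by
    refine hT.2 ⟨hT.1.1.sup_edge_of_not_reachable huv', fun x => ?_⟩ le_sup_left
    by_cases hx : x = u' ∨ x = v'
    · obtain ⟨y, hy⟩ : ∃ y, (T ⊔ SimpleGraph.edge u' v').neighborSet x ⊆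
          insert y (T.neighborSet x) := by
        rcases hx with rfl | rfl
        · refine ⟨v', fun w hw => ?_⟩
          simp [SimpleGraph.edge_adj] at hw ⊢
          grind
        · refine ⟨u', fun w hw => ?_⟩
          simp [SimpleGraph.edge_adj] at hw ⊢
          grind
      have h1 := (Set.ncard_le_ncard hy (Set.toFinite _)).trans (Set.ncard_insert_le _ _)
      have h2 : (T.neighborSet x).ncard ≤ 1 := by rcases hx with rfl | rfl <;> assumption
      omega
    · have : (T ⊔ SimpleGraph.edge u' v').neighborSet x = T.neighborSet x := by
        ext w
        simp [SimpleGraph.edge_adj]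
        grind
      rw [this]
      exact hT.1.2 x
  exact huv' (hle hadj).reachable

end Trees

/-! ### Attaching hanging edges -/

section Attach

attribute [instance] FinGraph.fin

lemma exists_injective_fin {α : Type*} {s : Set α} (hs : s.Finite) {k : ℕ} (h : k ≤ s.ncard) :
    ∃ f : Fin k → α, Function.Injective f ∧ ∀ i, f i ∈ s := by
  have := hs.to_subtype
  have := Fintype.ofFinite s
  obtain ⟨f⟩ := Function.Embedding.nonempty_of_card_le (α := Fin k) (β := s) (by
    rw [Fintype.card_fin, ← Nat.card_eq_fintype_card, Nat.card_coe_set_eq]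
    exact h)
  exact ⟨fun i => f i, Subtype.val_injective.comp f.injective, fun i => (f i).2⟩

variable {V : Type} {G : SimpleGraph V} {p : V → ℕ}

@[simp] lemma attachGraph_adj_inl_inl {u v : V} :
    (attachGraph G p).Adj (.inl u) (.inl v) ↔ G.Adj u v := Iff.rfl

@[simp] lemma attachGraph_adj_inl_inr {u : V} {w : Σ v : V, Fin (p v)} :
    (attachGraph G p).Adj (.inl u) (.inr w) ↔ u = w.1 := Iff.rfl

@[simp] lemma attachGraph_adj_inr_inl {u : V} {w : Σ v : V, Fin (p v)} :
    (attachGraph G p).Adj (.inr w) (.inl u) ↔ u = w.1 := Iff.rfl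

@[simp] lemma attachGraph_adj_inr_inr {w z : Σ v : V, Fin (p v)} :
    ¬ (attachGraph G p).Adj (.inr w) (.inr z) := id

variable (G p) in
/-- The inclusion of a graph into the graph with hanging edges attached. -/
def attachInl : G ↪g attachGraph G p where
  toFun := .inl
  inj' := Sum.inl_injective
  map_rel_iff' := Iff.rfl

lemma neighborSet_attachGraph_inr (w : Σ v : V, Fin (p v)) :
    (attachGraph G p).neighborSet (.inr w) = {.inl w.1} := by
  ext (u | z) <;> simp

lemma neighborSet_attachGraph_inl (v : V) :
    (attachGraph G p).neighborSet (.inl v) =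
      Sum.inl '' G.neighborSet v ∪ Set.range fun i : Fin (p v) => Sum.inr ⟨v, i⟩ := by
  ext (u | ⟨z, i⟩)
  · simp
  · simp only [SimpleGraph.mem_neighborSet, attachGraph_adj_inl_inr, Set.mem_union, Set.mem_image,
      reduceCtorEq, and_false, exists_false, false_or, Set.mem_range, Sum.inr.injEq]
    constructor
    · rintro rfl
      exact ⟨i, rfl⟩
    · rintro ⟨j, h⟩
      exact congrArg Sigma.fst h

lemma ncard_neighborSet_attachGraph_inl [Finite V] (v : V) :
    ((attachGraph G p).neighborSet (.inl v)).ncard = (G.neighborSet v).ncard + p v := by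
  rw [neighborSet_attachGraph_inl, Set.ncard_union_eq _ (Set.toFinite _) (Set.toFinite _),
    Set.ncard_image_of_injective _ Sum.inl_injective, ← Set.image_univ,
    Set.ncard_image_of_injective, Set.ncard_univ, Nat.card_fin]
  · intro i j h
    simpa using h
  · rw [Set.disjoint_left]
    rintro _ ⟨x, -, rfl⟩ ⟨i, h⟩
    exact Sum.inr_ne_inl h

/-- A rank certifies acyclicity and extends over hanging edges by a formula: a new vertex ranks one
above its base. -/
lemma exists_isRank_attachGraph (h : ∃ ρ, IsRank G ρ) : ∃ ρ, IsRank (attachGraph G p) ρ := by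
  obtain ⟨ρ, h1, h2⟩ := h
  refine ⟨Sum.elim ρ fun w => ρ w.1 + 1, ?_, ?_⟩
  · rintro (u | u) (v | v) h
    · exact h1 u v h
    · obtain rfl : u = v.1 := h
      simp
    · obtain rfl : v = u.1 := h
      simp
    · exact h.elim
  · rintro (u | u) (v | v) (w | w) h h' hv hw
    · exact congrArg _ (h2 u v w h h' hv hw)
    · obtain rfl : u = w.1 := h'
      simp at hw
    · obtain rfl : u = v.1 := h
      simp at hv
    · obtain rfl : u = v.1 := h
      simp at hv
    · exact congrArg _ (Eq.trans h (Eq.symm h'))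
    · exact h'.elim
    · exact h.elim
    · exact h.elim

lemma preconnected_attachGraph (h : G.Preconnected) : (attachGraph G p).Preconnected := by
  have h1 : ∀ u v : V, (attachGraph G p).Reachable (.inl u) (.inl v) := fun u v =>
    (h u v).map (attachInl G p).toHom
  have h2 : ∀ x, ∃ u : V, (attachGraph G p).Reachable x (.inl u) := by
    rintro (u | w)
    · exact ⟨u, SimpleGraph.Reachable.refl _⟩
    · exact ⟨w.1, SimpleGraph.Adj.reachable (by simp)⟩
  intro x y
  obtain ⟨u, hu⟩ := h2 x
  obtain ⟨v, hv⟩ := h2 y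
  exact (hu.trans (h1 u v)).trans hv.symm

/-- An injective homomorphism from a connected graph to an acyclic graph reflects adjacency. -/
lemma adj_of_adj_map {V W : Type*} {S : SimpleGraph V} {H : SimpleGraph W} (hS : S.Preconnected)
    (hH : H.IsAcyclic) (g : S →g H) (hg : Function.Injective g) {a b : V}
    (h : H.Adj (g a) (g b)) : S.Adj a b := by
  classical
  obtain ⟨q⟩ := hS a b
  have hq : ((q.toPath : S.Walk a b).map g).IsPath := q.toPath.2.map hg
  have heq := congrArg (fun r : H.Path (g a) (g b) => (r : H.Walk (g a) (g b)).length)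
    ((hH.subsingleton_path _ _).elim ⟨_, hq⟩ (SimpleGraph.Path.singleton h))
  simp only [SimpleGraph.Walk.length_map, SimpleGraph.Path.singleton,
    SimpleGraph.Walk.length_cons, SimpleGraph.Walk.length_nil] at heq
  exact SimpleGraph.Walk.adj_of_length_eq_one heq

/-- An injective homomorphism to an acyclic graph extends over new hanging edges if the degrees
allow it. -/
lemma exists_hom_attachGraph [Finite V] (hG : G.Preconnected) {W : Type*} {H : SimpleGraph W}
    [Finite W] (hH : H.IsAcyclic) (f : G →g H) (hf : Function.Injective f)
    (hdeg : ∀ v, (G.neighborSet v).ncard + p v ≤ (H.neighborSet (f v)).ncard) :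
    ∃ f' : attachGraph G p →g H, Function.Injective f' ∧ ∀ v, f' (.inl v) = f v := by
  -- The degree bound leaves `p v` neighbours of `f v` that are not images of neighbours of `v`. By
  -- acyclicity they avoid the image of `f` and differ for different `v`.
  have hnew : ∀ v, ∃ g : Fin (p v) → W, Function.Injective g ∧
      ∀ i, g i ∈ H.neighborSet (f v) \ f '' G.neighborSet v := by
    intro v
    refine exists_injective_fin (Set.toFinite _) ?_
    have h1 := Set.le_ncard_sdiff (f '' G.neighborSet v) (H.neighborSet (f v)) (Set.toFinite _)
    rw [Set.ncard_image_of_injective _ hf] at h1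
    have h2 := hdeg v
    omega
  choose g hg hgm using hnew
  have hgr : ∀ v i, g v i ∉ Set.range f := by
    rintro v i ⟨u, hu⟩
    have h1 := hgm v i
    rw [← hu] at h1
    exact h1.2 ⟨u, adj_of_adj_map hG hH f hf h1.1, rfl⟩
  refine ⟨⟨Sum.elim f fun w => g w.1 w.2, ?_⟩, ?_, fun v => rfl⟩
  · rintro (u | u) (v | v) h
    · exact f.map_adj h
    · obtain rfl : u = v.1 := h
      exact (hgm v.1 v.2).1
    · obtain rfl : v = u.1 := h
      exact (hgm u.1 u.2).1.symm
    · exact h.elim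
  · rintro (u | ⟨u, i⟩) (v | ⟨v, j⟩) h
    · exact congrArg _ (hf h)
    · exact absurd ⟨u, h⟩ (hgr v j)
    · exact absurd ⟨v, Eq.symm h⟩ (hgr u i)
    · have h : g u i = g v j := h
      obtain rfl : u = v := by
        refine eq_of_adj_of_adj hG hH f hf (hgr u i) (hgm u i).1.symm ?_
        rw [h]
        exact (hgm v j).1.symm
      rw [hg u h]

end Attach

/-! ### Degrees in the graphs `F n` and trees contained in them -/

namespace FinGraph

lemma deg_attach_inl (A : FinGraph) (p : A.V → ℕ) (v : A.V) :
    (A.attach p).deg (.inl v) = A.deg v + p v :=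
  ncard_neighborSet_attachGraph_inl v

lemma deg_attach_inr (A : FinGraph) (p : A.V → ℕ) (w : Σ v : A.V, Fin (p v)) :
    (A.attach p).deg (.inr w) = 1 := by
  rw [deg, neighborSet_attachGraph_inr, Set.ncard_singleton]

lemma deg_point (v : Unit) : point.deg v = 0 := by
  have : (point.graph).neighborSet v = ∅ := by
    ext w
    exact iff_of_false id id
  rw [deg, this, Set.ncard_empty]

lemma preconnected_point : point.graph.Preconnected := fun _ _ => SimpleGraph.Reachable.refl _

lemma deg_starGraph_inl (k : ℕ) (v : Unit) : (starGraph k).deg (.inl v) = k := by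
  rw [deg_attach_inl, deg_point, zero_add]

lemma preconnected_F (n : ℕ) : (F (n + 1)).graph.Preconnected := by
  induction n with
  | zero => exact preconnected_attachGraph preconnected_point
  | succ n ih => exact preconnected_attachGraph ih

lemma exists_isRank_F (n : ℕ) : ∃ ρ, IsRank (F (n + 1)).graph ρ := by
  induction n with
  | zero => exact exists_isRank_attachGraph ⟨fun _ => 0, fun _ _ h => h.elim, fun _ _ _ h => h.elim⟩
  | succ n ih => exact exists_isRank_attachGraph ih

lemma deg_F (n : ℕ) (v : (F (n + 1)).V) : (F (n + 1)).deg v = 1 ∨ (F (n + 1)).deg v = 3 := by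
  induction n with
  | zero =>
    rcases v with v | w
    · exact Or.inr (deg_starGraph_inl 3 v)
    · exact Or.inl (deg_attach_inr point _ w)
  | succ n ih =>
    rcases v with v | w
    · refine Or.inr ((deg_attach_inl (F (n + 1)) _ v).trans ?_)
      rcases ih v with h | h <;> simp [h]
    · exact Or.inl (deg_attach_inr (F (n + 1)) _ w)

/-- The inclusion of `F (n + 1)` in `F (n + 2)`. -/
noncomputable def FInl (n : ℕ) : (F (n + 1)).graph ↪g (F (n + 2)).graph :=
  attachInl (F (n + 1)).graph _

/-- Every vertex of one stage is a branching point of the next, so `R (n + 2)` has a hanging edge at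
each vertex coming from `F (n + 1)`. -/
lemma deg_FInl (n : ℕ) (v : (F (n + 1)).V) : (F (n + 2)).deg (FInl n v) = 3 := by
  refine (deg_attach_inl (F (n + 1)) _ v).trans ?_
  rcases deg_F n v with h | h <;> simp [h]

/-- A finite tree with all degrees at most three embeds in some `F n`. -/
lemma exists_embedding_F {V : Type*} [Finite V] {T : SimpleGraph V} (hT : T.IsTree)
    (hdeg : ∀ v, (T.neighborSet v).ncard ≤ 3) :
    ∃ n, Nonempty (T ↪g (F (n + 1)).graph) := by
  have : Nonempty (F (0 + 1)).V := ⟨.inl ()⟩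
  refine exists_embedding_of_isTree (W := fun n => (F (n + 1)).V)
    (H := fun n => (F (n + 1)).graph) FInl (fun i => ?_) (fun i v => ?_) _ T rfl hT hdeg
  · obtain ⟨ρ, hρ⟩ := exists_isRank_F i
    exact hρ.isAcyclic
  · have : Finite (F (i + 1 + 1)).V := FinGraph.fin _
    have h := deg_FInl i v
    rw [deg] at h
    rw [← (Set.toFinite _).cast_ncard_eq, h]
    rfl

end FinGraph

open FinGraph in
/-- A forest with degrees at most four in which every vertex of degree four has a neighbour of
degree one is contained in some `R n`. -/
lemma exists_hom_R {V : Type*} [Finite V] {G : SimpleGraph V} (hG : G.IsAcyclic)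
    (h4 : ∀ v, (G.neighborSet v).ncard ≤ 4)
    (hleaf : ∀ v, (G.neighborSet v).ncard = 4 → ∃ w, G.Adj v w ∧ (G.neighborSet w).ncard = 1) :
    ∃ n, 1 ≤ n ∧ ∃ f : G →g (R n).graph, Function.Injective f := by
  classical
  rcases isEmpty_or_nonempty V with hV | hV
  · exact ⟨1, le_rfl, ⟨fun v => (hV.false v).elim, fun {v} => (hV.false v).elim⟩,
      fun v => (hV.false v).elim⟩
  have hleaf' : ∀ v, ∃ w, (G.neighborSet v).ncard = 4 →
      G.Adj v w ∧ (G.neighborSet w).ncard = 1 := by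
    intro v
    by_cases h : (G.neighborSet v).ncard = 4
    · obtain ⟨w, hw⟩ := hleaf v h
      exact ⟨w, fun _ => hw⟩
    · exact ⟨v, fun h' => absurd h' h⟩
  choose l hl using hleaf'
  -- One leaf next to each vertex of degree four is set aside for the hanging edges of `R`; without
  -- its edge the degrees are at most three.
  let L : Set V := {u | ∃ w, (G.neighborSet w).ncard = 4 ∧ l w = u}
  let G' : SimpleGraph V :=
    { Adj := fun a b => G.Adj a b ∧ a ∉ L ∧ b ∉ L
      symm := ⟨fun a b h => ⟨h.1.symm, h.2.2, h.2.1⟩⟩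
      loopless := ⟨fun a h => G.loopless.irrefl a h.1⟩ }
  have hG' : G' ≤ G := fun a b h => h.1
  have hdeg : ∀ v, (G'.neighborSet v).ncard ≤ 3 := by
    intro v
    by_cases hv : (G.neighborSet v).ncard = 4
    · have h1 : G'.neighborSet v ⊆ G.neighborSet v \ {l v} := by
        intro w hw
        refine ⟨hw.1, ?_⟩
        rintro rfl
        exact hw.2.2 ⟨v, hv, rfl⟩
      have h2 := Set.ncard_le_ncard h1 (Set.toFinite _)
      have h3 := Set.ncard_sdiff_singleton_add_one (s := G.neighborSet v) (hl v hv).1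
        (Set.toFinite _)
      omega
    · have h2 : (G'.neighborSet v).ncard ≤ (G.neighborSet v).ncard :=
        Set.ncard_le_ncard (fun w hw => hw.1) (Set.toFinite _)
      have := h4 v
      omega
  obtain ⟨T, hGT, hT, hTdeg⟩ := exists_isTree_ge (hG.anti hG') hdeg
  obtain ⟨n, ⟨f⟩⟩ := exists_embedding_F hT hTdeg
  let g : T ↪g (F (n + 2)).graph := (FInl n).comp f
  have hg : ∀ v, (F (n + 2)).deg (g v) = 3 := fun v => deg_FInl n (f v)
  have hpar : ∀ u, ∃ w, u ∈ L → (G.neighborSet w).ncard = 4 ∧ l w = u := by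
    intro u
    by_cases h : u ∈ L
    · obtain ⟨w, hw⟩ := h
      exact ⟨w, fun _ => hw⟩
    · exact ⟨u, fun h' => absurd h' h⟩
  choose par hpar using hpar
  have hL : ∀ a b, G.Adj a b → a ∈ L → b = par a ∧ b ∉ L := by
    intro a b hab ha
    obtain ⟨h1, h2⟩ := hpar a ha
    have h3 := hl (par a) h1
    rw [h2] at h3
    obtain ⟨c, hc⟩ := Set.ncard_eq_one.1 h3.2
    have hb : b ∈ G.neighborSet a := hab
    have hp : par a ∈ G.neighborSet a := h3.1.symm
    rw [hc, Set.mem_singleton_iff] at hb hp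
    have hba : b = par a := hb.trans hp.symm
    refine ⟨hba, ?_⟩
    -- The vertex `b` has degree four, while members of `L` have degree one.
    rintro ⟨w, hw4, hwb⟩
    have h5 := (hl w hw4).2
    rw [hwb, hba, h1] at h5
    omega
  let q : (F (n + 2)).V → ℕ := fun v => if 3 ≤ (F (n + 2)).deg v then 1 else 0
  have hq : ∀ v, 0 < q (g v) := fun v => by simp [q, hg v]
  -- Vertices of `L` are also vertices of the tree `T`, but their images under `g` are not used.
  let φ : V → (R (n + 2)).V := fun u =>
    if u ∈ L then .inr ⟨g (par u), ⟨0, hq _⟩⟩ else .inl (g u)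
  have hφL : ∀ u, u ∈ L → φ u = .inr ⟨g (par u), ⟨0, hq _⟩⟩ := fun u hu => if_pos hu
  have hφ : ∀ u, u ∉ L → φ u = .inl (g u) := fun u hu => if_neg hu
  have hadj : ∀ a b, G.Adj a b → a ∈ L → (R (n + 2)).graph.Adj (φ a) (φ b) := by
    intro a b hab ha
    obtain ⟨h1, h2⟩ := hL a b hab ha
    rw [hφL a ha, hφ b h2]
    exact congrArg g h1
  refine ⟨n + 2, by omega, ⟨φ, ?_⟩, ?_⟩
  · intro a b hab
    by_cases ha : a ∈ L
    · exact hadj a b hab ha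
    by_cases hb : b ∈ L
    · exact (hadj b a hab.symm hb).symm
    rw [hφ a ha, hφ b hb]
    exact g.map_adj_iff.2 (hGT ⟨hab, ha, hb⟩)
  · intro a b (hab : φ a = φ b)
    by_cases ha : a ∈ L <;> by_cases hb : b ∈ L
    · rw [hφL a ha, hφL b hb] at hab
      have h1 : g (par a) = g (par b) := congrArg Sigma.fst (Sum.inr_injective hab)
      rw [← (hpar a ha).2, ← (hpar b hb).2, g.injective h1]
    · rw [hφL a ha, hφ b hb] at hab
      exact absurd hab Sum.inr_ne_inl
    · rw [hφ a ha, hφL b hb] at hab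
      exact absurd hab Sum.inl_ne_inr
    · rw [hφ a ha, hφ b hb] at hab
      exact g.injective (Sum.inl_injective hab)

open FinGraph in
/-- A finite graph without circles, pentodes and crosses with branched ends is contained in
some `R n`. -/
lemma isContainedIn_R_of_not_hasSubgraph {K : Type*} [TopologicalSpace K] (hK : IsFiniteGraph K)
    (h1 : ¬ HasSubgraphHomeomorphicTo K Circle)
    (h2 : ¬ HasSubgraphHomeomorphicTo K (starGraph 5).Space)
    (h3 : ¬ HasSubgraphHomeomorphicTo K crossBranched.Space) :
    ∃ n : ℕ, 1 ≤ n ∧ IsContainedIn K (R n).Space := by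
  classical
  obtain ⟨n, G, ⟨e⟩, hpres⟩ := hK.exists_presentation
  have hG := isAcyclic_of_not_hasSubgraph_circle e h1
  have hstar : ∀ v k, k ≤ (G.neighborSet v).ncard →
      ∃ f : (starGraph k).graph →g G, Function.Injective f ∧ f (.inl ()) = v := by
    intro v k hk
    obtain ⟨f, hf, hfv⟩ := exists_hom_attachGraph (p := fun _ => k) preconnected_point hG
      ⟨fun _ => v, fun h => h.elim⟩ (fun _ _ _ => rfl) (fun u => by
        have := deg_point u
        rw [deg] at this
        rw [this, zero_add]
        exact hk)
    exact ⟨f, hf, hfv ()⟩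
  have h4 : ∀ v, (G.neighborSet v).ncard ≤ 4 := by
    intro v
    by_contra hv
    obtain ⟨f, hf, -⟩ := hstar v 5 (by omega)
    exact h2 (hasSubgraph_of_hom e (Homeomorph.refl _) f hf)
  have hleaf : ∀ v, (G.neighborSet v).ncard = 4 →
      ∃ w, G.Adj v w ∧ (G.neighborSet w).ncard = 1 := by
    intro v hv
    by_contra hcon
    push Not at hcon
    -- A neighbour of `v` is no leaf by assumption; with degree two it would lie in a triangle, by
    -- the choice of the presentation.
    have hge : ∀ w, G.Adj v w → 3 ≤ (G.neighborSet w).ncard := by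
      intro w hw
      have h5 := hcon w hw
      have h6 : (G.neighborSet w).ncard ≠ 0 := by
        rw [Ne, Set.ncard_eq_zero (Set.toFinite _)]
        exact Set.Nonempty.ne_empty ⟨v, hw.symm⟩
      have h7 : (G.neighborSet w).ncard ≠ 2 := by
        intro h
        obtain ⟨a, b, hab, hN⟩ := Set.ncard_eq_two.1 h
        have hN' : ∀ x, G.Adj w x ↔ x = a ∨ x = b := fun x => by
          rw [← SimpleGraph.mem_neighborSet, hN]
          rfl
        have hadj := hpres w a b hab hN'
        refine hG.cliqueFree (n := 3) le_rfl {w, a, b} ?_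
        rw [SimpleGraph.is3Clique_triple_iff]
        exact ⟨(hN' a).2 (Or.inl rfl), (hN' b).2 (Or.inr rfl), hadj⟩
      omega
    obtain ⟨f, hf, hfv⟩ := hstar v 4 hv.ge
    obtain ⟨f', hf', -⟩ := exists_hom_attachGraph
      (p := fun u => if (starGraph 4).deg u = 1 then 2 else 0)
      (preconnected_attachGraph preconnected_point) hG f hf (by
        rintro (u | w)
        · have h5 := deg_starGraph_inl 4 u
          rw [h5]
          rw [deg] at h5
          rw [h5, hfv, hv]
          simp
        · have h5 := deg_attach_inr point (fun _ => 4) w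
          rw [if_pos h5]
          rw [deg] at h5
          rw [h5]
          refine hge _ ?_
          rw [← hfv]
          exact f.map_adj rfl)
    exact h3 (hasSubgraph_of_hom e (Homeomorph.refl _) f' hf')
  obtain ⟨m, hm, f, hf⟩ := exists_hom_R hG h4 hleaf
  exact ⟨m, hm, _, (isEmbedding_realizationMap f hf).comp e.isEmbedding⟩

/-! ### Constructions of basic sets -/

section Basic

lemma isBasic_iff {S : Set (ℝ × ℝ)} : IsBasic S ↔ ∀ f : ℝ × ℝ → ℝ, ContinuousOn f S →
    ∃ g h : ℝ → ℝ, Continuous g ∧ Continuous h ∧ ∀ p ∈ S, f p = g p.1 + h p.2 := by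
  classical
  constructor
  · intro H f hf
    obtain ⟨g, h, hg, hh, e⟩ := H (S.domRestrict f) hf.domRestrict
    exact ⟨g, h, hg, hh, fun p hp => e ⟨p, hp⟩⟩
  · intro H f hf
    have hres : S.domRestrict (fun p => if hp : p ∈ S then f ⟨p, hp⟩ else 0) = f := by
      ext p
      simp
    obtain ⟨g, h, hg, hh, e⟩ := H (fun p => if hp : p ∈ S then f ⟨p, hp⟩ else 0)
      (continuousOn_iff_continuous_domRestrict.2 (by rwa [hres]))
    refine ⟨g, h, hg, hh, fun p => ?_⟩
    rw [← e p p.2]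
    simp

/-- Tietze extension for functions that are continuous on a closed set. -/
lemma exists_continuous_eqOn {X : Type*} [TopologicalSpace X] [NormalSpace X] {C : Set X}
    (hC : IsClosed C) {u : X → ℝ} (hu : ContinuousOn u C) :
    ∃ v : X → ℝ, Continuous v ∧ ∀ x ∈ C, v x = u x := by
  obtain ⟨v, hv⟩ := ContinuousMap.exists_restrict_eq hC ⟨C.domRestrict u, hu.domRestrict⟩
  refine ⟨v, v.continuous, fun x hx => ?_⟩
  exact congrArg (fun w : C(C, ℝ) => w ⟨x, hx⟩) hv

/-- By Tietze's theorem a continuous function on the closed set `T` extends to the plane, in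
particular to `S`. -/
lemma IsBasic.mono {S T : Set (ℝ × ℝ)} (hS : IsBasic S) (hT : IsClosed T) (hTS : T ⊆ S) :
    IsBasic T := by
  rw [isBasic_iff] at hS ⊢
  intro f hf
  obtain ⟨v, hv, hvf⟩ := exists_continuous_eqOn hT hf
  obtain ⟨g, h, hg, hh, e⟩ := hS v hv.continuousOn
  exact ⟨g, h, hg, hh, fun p hp => by rw [← hvf p hp, e p (hTS hp)]⟩

lemma isBasic_singleton (p : ℝ × ℝ) : IsBasic {p} := by
  rw [isBasic_iff]
  intro f _
  refine ⟨fun _ => f p, fun _ => 0, continuous_const, continuous_const, ?_⟩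
  rintro _ rfl
  simp

lemma IsBasic.swap {S : Set (ℝ × ℝ)} (hS : IsBasic S) : IsBasic (Prod.swap '' S) := by
  rw [isBasic_iff] at hS ⊢
  intro f hf
  obtain ⟨g, h, hg, hh, e⟩ := hS (f ∘ Prod.swap)
    (hf.comp continuous_swap.continuousOn (Set.mapsTo_image _ _))
  refine ⟨h, g, hh, hg, ?_⟩
  rintro _ ⟨p, hp, rfl⟩
  rw [add_comm]
  exact e p hp

lemma IsBasic.image_prodMap {S : Set (ℝ × ℝ)} (hS : IsBasic S) (u v : ℝ ≃ₜ ℝ) :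
    IsBasic (Prod.map u v '' S) := by
  rw [isBasic_iff] at hS ⊢
  intro f hf
  obtain ⟨g, h, hg, hh, e⟩ := hS (f ∘ Prod.map u v)
    (hf.comp (u.continuous.prodMap v.continuous).continuousOn (Set.mapsTo_image _ _))
  refine ⟨g ∘ u.symm, h ∘ v.symm, hg.comp u.symm.continuous, hh.comp v.symm.continuous, ?_⟩
  rintro _ ⟨p, hp, rfl⟩
  simpa using e p hp

/-- A compact basic set remains basic when the graph of a continuous function over a closed set
is added, if the points of the graph over the first projection of the set belong to the set. -/
lemma IsBasic.union_graph {S : Set (ℝ × ℝ)} (hS : IsBasic S) (hSc : IsCompact S) {X : Set ℝ}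
    (hX : IsClosed X) {u : ℝ → ℝ} (hu : Continuous u)
    (h : ∀ x ∈ X, x ∈ Prod.fst '' S → (x, u x) ∈ S) :
    IsBasic (S ∪ (fun x => (x, u x)) '' X) := by
  classical
  rw [isBasic_iff] at hS ⊢
  intro f hf
  obtain ⟨g, k, hg, hk, e⟩ := hS f (hf.mono Set.subset_union_left)
  -- The function of `y` is kept, and that of `x` is redefined over `X` so that the sum is right on
  -- the graph. By `h` it agrees with the old one over the projection of `S`.
  let w : ℝ → ℝ := fun x => if x ∈ X then f (x, u x) - k (u x) else g x
  have hw1 : ∀ x ∈ X, w x = f (x, u x) - k (u x) := fun x hx => if_pos hx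
  have hw2 : ∀ x ∈ Prod.fst '' S, w x = g x := by
    intro x hx
    by_cases hxX : x ∈ X
    · rw [hw1 x hxX, e _ (h x hxX hx)]
      simp
    · exact if_neg hxX
  have hc1 : ContinuousOn w X := by
    refine ContinuousOn.congr ?_ hw1
    refine ContinuousOn.sub (hf.comp (by fun_prop) ?_) (by fun_prop)
    intro x hx
    exact Or.inr ⟨x, hx, rfl⟩
  have hc2 : ContinuousOn w (Prod.fst '' S) := hg.continuousOn.congr hw2
  have hcl : IsClosed (Prod.fst '' S) := (hSc.image continuous_fst).isClosed
  obtain ⟨v, hv, hvw⟩ := exists_continuous_eqOn (hX.union hcl) (hc1.union_of_isClosed hc2 hX hcl)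
  refine ⟨v, k, hv, hk, ?_⟩
  rintro p (hp | ⟨x, hx, rfl⟩)
  · rw [hvw _ (Or.inr ⟨p, hp, rfl⟩), hw2 _ ⟨p, hp, rfl⟩, e p hp]
  · simp only
    rw [hvw _ (Or.inl hx), hw1 _ hx]
    ring

lemma IsBasic.union_graph' {S : Set (ℝ × ℝ)} (hS : IsBasic S) (hSc : IsCompact S) {Y : Set ℝ}
    (hY : IsClosed Y) {u : ℝ → ℝ} (hu : Continuous u)
    (h : ∀ y ∈ Y, y ∈ Prod.snd '' S → (u y, y) ∈ S) :
    IsBasic (S ∪ (fun y => (u y, y)) '' Y) := by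
  have := (hS.swap.union_graph (hSc.image continuous_swap) hY hu ?_).swap
  · rw [Set.image_union, Set.image_image, Set.image_image] at this
    simpa using this
  · rintro y hy ⟨_, ⟨p, hp, rfl⟩, hpy⟩
    exact ⟨_, h y hy ⟨p, hp, hpy⟩, rfl⟩

lemma IsBasic.union {S T : Set (ℝ × ℝ)} (hS : IsBasic S) (hSc : IsCompact S) (hT : IsBasic T)
    (hTc : IsCompact T) (h1 : Disjoint (Prod.fst '' S) (Prod.fst '' T))
    (h2 : Disjoint (Prod.snd '' S) (Prod.snd '' T)) : IsBasic (S ∪ T) := by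
  classical
  have glue : ∀ {A B : Set ℝ}, IsCompact A → IsCompact B → Disjoint A B → ∀ {u v : ℝ → ℝ},
      Continuous u → Continuous v →
      ∃ w : ℝ → ℝ, Continuous w ∧ (∀ x ∈ A, w x = u x) ∧ ∀ x ∈ B, w x = v x := by
    intro A B hA hB hAB u v hu hv
    have e1 : ∀ x ∈ A, A.piecewise u v x = u x := fun x hx => Set.piecewise_eq_of_mem _ _ _ hx
    have e2 : ∀ x ∈ B, A.piecewise u v x = v x := fun x hx =>
      Set.piecewise_eq_of_notMem _ _ _ (Set.disjoint_right.1 hAB hx)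
    obtain ⟨w, hw, hw'⟩ := exists_continuous_eqOn (hA.isClosed.union hB.isClosed)
      ((hu.continuousOn.congr e1).union_of_isClosed (hv.continuousOn.congr e2) hA.isClosed
        hB.isClosed)
    exact ⟨w, hw, fun x hx => (hw' x (Or.inl hx)).trans (e1 x hx),
      fun x hx => (hw' x (Or.inr hx)).trans (e2 x hx)⟩
  rw [isBasic_iff] at hS hT ⊢
  intro f hf
  obtain ⟨g, h, hg, hh, e⟩ := hS f (hf.mono Set.subset_union_left)
  obtain ⟨g', h', hg', hh', e'⟩ := hT f (hf.mono Set.subset_union_right)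
  obtain ⟨G, hG, hG1, hG2⟩ := glue (hSc.image continuous_fst) (hTc.image continuous_fst) h1 hg hg'
  obtain ⟨H, hH, hH1, hH2⟩ := glue (hSc.image continuous_snd) (hTc.image continuous_snd) h2 hh hh'
  refine ⟨G, H, hG, hH, ?_⟩
  rintro p (hp | hp)
  · rw [hG1 _ ⟨p, hp, rfl⟩, hH1 _ ⟨p, hp, rfl⟩, e p hp]
  · rw [hG2 _ ⟨p, hp, rfl⟩, hH2 _ ⟨p, hp, rfl⟩, e' p hp]

end Basic

/-! ### A basic drawing of the binary tree with hanging edges -/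

section Drawing

/-- The two similarities that place the subtrees at the children of the root. -/
noncomputable def place : Bool → ℝ × ℝ → ℝ × ℝ
  | false => fun p => (1 + p.1 / 8, -1 + p.2 / 8)
  | true => fun p => (3 + p.2 / 8, 1 + p.1 / 8)

lemma continuous_place (b : Bool) : Continuous (place b) := by
  cases b <;> unfold place <;> fun_prop

lemma place_injective (b : Bool) : Function.Injective (place b) := by
  intro p q h
  cases b <;> simp only [place, Prod.mk.injEq] at h <;> ext <;> linarith [h.1, h.2]

/-- The similarity of the line with ratio `1 / 8`. -/
noncomputable def scale (c : ℝ) : ℝ ≃ₜ ℝ :=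
  (Homeomorph.mulRight₀ (1 / 8 : ℝ) (by norm_num)).trans (Homeomorph.addLeft c)

lemma scale_apply (c x : ℝ) : scale c x = c + x / 8 := by
  simp [scale, div_eq_mul_inv]

lemma IsBasic.image_place {S : Set (ℝ × ℝ)} (hS : IsBasic S) (b : Bool) :
    IsBasic (place b '' S) := by
  cases b
  · have : place false = Prod.map (scale 1) (scale (-1)) := by
      ext p <;> simp [place, scale_apply]
    rw [this]
    exact hS.image_prodMap _ _
  · have : place true = Prod.map (scale 3) (scale 1) ∘ Prod.swap := by
      ext p <;> simp [place, scale_apply]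
    rw [this, Set.image_comp]
    exact hS.swap.image_prodMap _ _

/-- The drawing of the binary tree of depth `n` with hanging edges. -/
noncomputable def drawing : ℕ → Set (ℝ × ℝ)
  | 0 => {0}
  | n + 1 => ((((place false '' drawing n ∪ place true '' drawing n) ∪
      (fun x => (x, 0)) '' Set.Icc 0 (1 / 2)) ∪
      (fun y => (-y, y)) '' Set.Icc (-(1 / 2)) 0) ∪
      (fun x => (x, -x)) '' Set.Icc (1 / 2) 1) ∪
      (fun y => (3 * y, y)) '' Set.Icc 0 1

lemma isCompact_drawing (n : ℕ) : IsCompact (drawing n) := by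
  induction n with
  | zero => exact isCompact_singleton
  | succ n ih =>
    refine ((((((ih.image (continuous_place _)).union (ih.image (continuous_place _))).union
      (isCompact_Icc.image ?_)).union (isCompact_Icc.image ?_)).union
      (isCompact_Icc.image ?_)).union (isCompact_Icc.image ?_))
    all_goals fun_prop

lemma zero_mem_drawing (n : ℕ) : (0 : ℝ × ℝ) ∈ drawing n := by
  cases n with
  | zero => rfl
  | succ n => exact Or.inr ⟨0, by simp, by simp⟩

/-- These bounds put the two copies into `[1, 3/2] × [-5/4, -3/4]` and `[11/4, 13/4] × [1, 3/2]`.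
Their projections to either axis are disjoint, and the root of the first copy is on the left side of
its box, that of the second on the lower side. -/
lemma drawing_subset (n : ℕ) :
    ∀ p ∈ drawing n, 0 ≤ p.1 ∧ p.1 ≤ 4 ∧ -2 ≤ p.2 ∧ p.2 ≤ 2 := by
  induction n with
  | zero =>
    rintro _ rfl
    norm_num
  | succ n ih =>
    rintro p (((((⟨q, hq, rfl⟩ | ⟨q, hq, rfl⟩) | ⟨x, hx, rfl⟩) | ⟨x, hx, rfl⟩) | ⟨x, hx, rfl⟩) |
      ⟨x, hx, rfl⟩)
    · obtain ⟨h1, h2, h3, h4⟩ := ih q hq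
      refine ⟨?_, ?_, ?_, ?_⟩ <;> simp only [place] <;> linarith
    · obtain ⟨h1, h2, h3, h4⟩ := ih q hq
      refine ⟨?_, ?_, ?_, ?_⟩ <;> simp only [place] <;> linarith
    all_goals
      obtain ⟨h1, h2⟩ := hx
      refine ⟨?_, ?_, ?_, ?_⟩ <;> simp only <;> linarith

/-- Each arc is added as a graph over a free coordinate. The edge to the first child starts over
`y`, since the hanging edge occupies `x` in `[0, 1/2]`, and ends over `x`, since the copy may occupy
`y` near `-1` but begins only at `x = 1`. The edge to the second child is a graph over `y`; for this
the second copy is reflected, so that it lies in `y ≥ 1`. -/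
lemma isBasic_drawing (n : ℕ) : IsBasic (drawing n) := by
  induction n with
  | zero => exact isBasic_singleton _
  | succ n ih =>
    have hc := isCompact_drawing n
    have hb := drawing_subset n
    have h0 := zero_mem_drawing n
    have c0 := (hc.image (continuous_place false)).union (hc.image (continuous_place true))
    have c1 := c0.union (isCompact_Icc.image (f := fun x : ℝ => (x, (0 : ℝ)))
      (s := Set.Icc 0 (1 / 2)) (by fun_prop))
    have c2 := c1.union (isCompact_Icc.image (f := fun y : ℝ => (-y, y))
      (s := Set.Icc (-(1 / 2)) 0) (by fun_prop))
    have c3 := c2.union (isCompact_Icc.image (f := fun x : ℝ => (x, -x))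
      (s := Set.Icc (1 / 2) 1) (by fun_prop))
    have b0 : IsBasic (place false '' drawing n ∪ place true '' drawing n) := by
      refine (ih.image_place _).union (hc.image (continuous_place _)) (ih.image_place _)
        (hc.image (continuous_place _)) ?_ ?_
      · rw [Set.disjoint_left]
        rintro _ ⟨_, ⟨p, hp, rfl⟩, rfl⟩ ⟨_, ⟨q, hq, rfl⟩, h⟩
        have hp' := hb p hp
        have hq' := hb q hq
        simp only [place] at h
        linarith
      · rw [Set.disjoint_left]
        rintro _ ⟨_, ⟨p, hp, rfl⟩, rfl⟩ ⟨_, ⟨q, hq, rfl⟩, h⟩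
        have hp' := hb p hp
        have hq' := hb q hq
        simp only [place] at h
        linarith
    have b1 := b0.union_graph c0 (X := Set.Icc 0 (1 / 2)) isClosed_Icc
      (u := fun _ => 0) continuous_const (by
        rintro x hx ⟨_, ⟨p, hp, rfl⟩ | ⟨p, hp, rfl⟩, rfl⟩ <;> exfalso
        all_goals
          have hp' := hb p hp
          have hx' := hx.2
          simp only [place] at hx'
          linarith)
    have b2 := b1.union_graph' c1 (Y := Set.Icc (-(1 / 2)) 0) isClosed_Icc
      (u := fun y => -y) continuous_neg (by
        rintro y hy ⟨_, (⟨p, hp, rfl⟩ | ⟨p, hp, rfl⟩) | ⟨x, hx, rfl⟩, rfl⟩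
        · exfalso
          have hp' := hb p hp
          have hy' := hy.1
          simp only [place] at hy'
          linarith
        · exfalso
          have hp' := hb p hp
          have hy' := hy.2
          simp only [place] at hy'
          linarith
        · exact Or.inr ⟨0, by simp, by simp⟩)
    have b3 := b2.union_graph c2 (X := Set.Icc (1 / 2) 1) isClosed_Icc
      (u := fun x => -x) continuous_neg (by
        rintro x hx ⟨_, ((⟨p, hp, rfl⟩ | ⟨p, hp, rfl⟩) | ⟨z, hz, rfl⟩) | ⟨z, hz, rfl⟩, rfl⟩
        · have hp' := hb p hp
          have hx' := hx.2
          simp only [place] at hx' ⊢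
          have : p.1 = 0 := by linarith
          refine Or.inl (Or.inl (Or.inl ⟨0, h0, ?_⟩))
          simp [this]
        · exfalso
          have hp' := hb p hp
          have hx' := hx.2
          simp only [place] at hx'
          linarith
        · have hx' := hx.1
          have hz' := hz.2
          simp only at hx' ⊢
          have : z = 1 / 2 := le_antisymm hz' hx'
          exact Or.inr ⟨-(1 / 2), by norm_num, by simp [this]⟩
        · have hx' := hx.1
          have hz' := hz.1
          simp only at hx' ⊢
          exact Or.inr ⟨z, hz, by simp⟩)
    refine b3.union_graph' c3 (Y := Set.Icc 0 1) isClosed_Icc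
      (u := fun y => 3 * y) (by fun_prop) ?_
    rintro y hy ⟨_, (((⟨p, hp, rfl⟩ | ⟨p, hp, rfl⟩) | ⟨z, hz, rfl⟩) | ⟨z, hz, rfl⟩) |
      ⟨z, hz, rfl⟩, rfl⟩
    · exfalso
      have hp' := hb p hp
      have hy' := hy.1
      simp only [place] at hy'
      linarith
    · have hp' := hb p hp
      have hy' := hy.2
      simp only [place] at hy' ⊢
      have : p.1 = 0 := by linarith
      refine Or.inl (Or.inl (Or.inl (Or.inr ⟨0, h0, ?_⟩)))
      simp [this]
    · exact Or.inl (Or.inl (Or.inr ⟨0, by simp, by simp⟩))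
    · have hy' := hy.1
      have hz' := hz.2
      simp only at hy' ⊢
      have : z = 0 := le_antisymm hz' hy'
      exact Or.inl (Or.inl (Or.inr ⟨0, by simp, by simp [this]⟩))
    · exfalso
      have hy' := hy.1
      have hz' := hz.1
      simp only at hy'
      linarith

end Drawing

/-! ### The binary tree with hanging edges -/

section BinaryTree

/-- The infinite binary tree: its vertices are finite words, the children of a word are obtained
by appending a letter. -/
def binaryTree : SimpleGraph (List Bool) where
  Adj l m := (∃ b, m = l ++ [b]) ∨ ∃ b, l = m ++ [b]
  symm := ⟨fun _ _ h => h.symm⟩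
  loopless := ⟨fun l h => by rcases h with ⟨b, h⟩ | ⟨b, h⟩ <;> simp at h⟩

lemma isRank_binaryTree : IsRank binaryTree List.length := by
  constructor
  · rintro u v (⟨b, rfl⟩ | ⟨b, rfl⟩) <;> simp
  · rintro u v w (⟨b, rfl⟩ | ⟨b, rfl⟩) (⟨c, rfl⟩ | ⟨c, h⟩) hv hw
    · simp at hv
    · simp at hv
    · simp at hw
    · exact (List.append_inj' h rfl).1

/-- The subtree over the second child of the root. -/
def binaryTreeCons : binaryTree ↪g binaryTree where
  toFun l := true :: l
  inj' := List.cons_injective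
  map_rel_iff' := by
    intro l m
    simp [binaryTree]

lemma three_le_encard_neighborSet_binaryTree {l : List Bool} (hl : l ≠ []) :
    3 ≤ (binaryTree.neighborSet l).encard := by
  have h : ({l.dropLast, l ++ [false], l ++ [true]} : Set (List Bool)) ⊆
      binaryTree.neighborSet l := by
    rintro _ (rfl | rfl | rfl)
    · exact Or.inr ⟨_, (List.dropLast_append_getLast hl).symm⟩
    · exact Or.inl ⟨_, rfl⟩
    · exact Or.inl ⟨_, rfl⟩
  have hne : ∀ b, l.dropLast ≠ l ++ [b] := by
    intro b hb
    have := congrArg List.length hb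
    simp at this
  refine le_trans (le_of_eq ?_) (Set.encard_le_encard h)
  rw [Set.encard_eq_three.2 ⟨_, _, _, hne false, hne true, by simp, rfl⟩]

/-- The root has degree two only and is avoided by prefixing a letter to all words; the sequence of
ambient graphs is constant here. -/
lemma exists_embedding_binaryTree {V : Type*} [Finite V] {T : SimpleGraph V} (hT : T.IsTree)
    (hdeg : ∀ v, (T.neighborSet v).ncard ≤ 3) :
    ∃ f : T ↪g binaryTree, ∀ v, f v ≠ [] := by
  obtain ⟨i, ⟨f⟩⟩ := exists_embedding_of_isTree (W := fun _ => List Bool)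
    (H := fun _ => binaryTree) (fun _ => binaryTreeCons) (fun _ => isRank_binaryTree.isAcyclic)
    (fun _ v => three_le_encard_neighborSet_binaryTree (List.cons_ne_nil _ _)) _ T rfl hT hdeg
  exact ⟨binaryTreeCons.comp f, fun v => List.cons_ne_nil _ _⟩

/-- The position of a vertex of the binary tree in the plane. -/
noncomputable def position : List Bool → ℝ × ℝ
  | [] => 0
  | b :: l => place b (position l)

/-- The end of the hanging edge at a vertex of the binary tree. -/
noncomputable def hangPosition : List Bool → ℝ × ℝ
  | [] => (1 / 2, 0)
  | b :: l => place b (hangPosition l)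

/-- The lower end of an edge: a child or the end of the hanging edge. -/
def lowerEnd (w : List Bool) : Option Bool → List Bool ⊕ List Bool
  | some b => .inl (w ++ [b])
  | none => .inr w

/-- The positions of all vertices. -/
noncomputable def position' : List Bool ⊕ List Bool → ℝ × ℝ :=
  Sum.elim position hangPosition

/-- The point of the drawing that divides an edge in a given ratio. -/
noncomputable def drawPoint (w : List Bool) (c : Option Bool) (t : ℝ) : ℝ × ℝ :=
  (1 - t) • position w + t • position' (lowerEnd w c)

/-- Children are appended at the end of a word, while `position` recurses on its head. A leading
letter therefore acts on whole edges by an affine map. -/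
lemma drawPoint_cons (b : Bool) (w : List Bool) (c : Option Bool) (t : ℝ) :
    drawPoint (b :: w) c t = place b (drawPoint w c t) := by
  rcases c with _ | d <;> cases b <;>
    ext <;> simp [drawPoint, position', lowerEnd, position, hangPosition, place] <;> ring

lemma drawPoint_nil_none (t : ℝ) : drawPoint [] none t = (t / 2, 0) := by
  ext <;> simp [drawPoint, position', lowerEnd, position, hangPosition]
  ring

lemma drawPoint_nil_false (t : ℝ) : drawPoint [] (some false) t = (t, -t) := by
  ext <;> simp [drawPoint, position', lowerEnd, position, place]

lemma drawPoint_nil_true (t : ℝ) : drawPoint [] (some true) t = (3 * t, t) := by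
  ext <;> simp [drawPoint, position', lowerEnd, position, place]
  ring

lemma drawPoint_mem_drawing (n : ℕ) {w : List Bool} (hw : w.length < n) (c : Option Bool) {t : ℝ}
    (ht : t ∈ Set.Icc (0 : ℝ) 1) : drawPoint w c t ∈ drawing n := by
  induction n generalizing w with
  | zero => simp at hw
  | succ n ih =>
    rcases w with _ | ⟨b, w⟩
    · rcases c with _ | _ | _
      · rw [drawPoint_nil_none]
        exact Or.inl (Or.inl (Or.inl (Or.inr ⟨t / 2, ⟨by linarith [ht.1], by linarith [ht.2]⟩,
          rfl⟩)))
      · rw [drawPoint_nil_false]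
        rcases le_total t (1 / 2) with h | h
        · exact Or.inl (Or.inl (Or.inr ⟨-t, ⟨by linarith, by linarith [ht.1]⟩, by simp⟩))
        · exact Or.inl (Or.inr ⟨t, ⟨h, ht.2⟩, rfl⟩)
      · rw [drawPoint_nil_true]
        exact Or.inr ⟨t, ht, rfl⟩
    · rw [drawPoint_cons]
      have := ih (w := w) (by simpa using hw)
      cases b
      · exact Or.inl (Or.inl (Or.inl (Or.inl (Or.inl ⟨_, this, rfl⟩))))
      · exact Or.inl (Or.inl (Or.inl (Or.inl (Or.inr ⟨_, this, rfl⟩))))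

/-- Strict positivity of the first coordinate separates a copy, its root excepted, from the edge
arriving at that root. -/
lemma drawPoint_bounds (w : List Bool) (c : Option Bool) {t : ℝ} (ht : t ∈ Set.Ioc (0 : ℝ) 1) :
    0 < (drawPoint w c t).1 ∧ (drawPoint w c t).1 ≤ 4 ∧ -2 ≤ (drawPoint w c t).2 ∧
      (drawPoint w c t).2 ≤ 2 := by
  obtain ⟨h0, h1⟩ := ht
  induction w with
  | nil =>
    rcases c with _ | _ | _
    · rw [drawPoint_nil_none]
      refine ⟨?_, ?_, ?_, ?_⟩ <;> simp only <;> linarith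
    · rw [drawPoint_nil_false]
      refine ⟨?_, ?_, ?_, ?_⟩ <;> simp only <;> linarith
    · rw [drawPoint_nil_true]
      refine ⟨?_, ?_, ?_, ?_⟩ <;> simp only <;> linarith
  | cons b w ih =>
    obtain ⟨h2, h3, h4, h5⟩ := ih
    rw [drawPoint_cons]
    cases b <;> refine ⟨?_, ?_, ?_, ?_⟩ <;> simp only [place] <;> linarith

lemma drawPoint_nil_ne_cons (c c' : Option Bool) (b : Bool) (w : List Bool) {t s : ℝ}
    (ht : t ∈ Set.Ioc (0 : ℝ) 1) (hs : s ∈ Set.Ioc (0 : ℝ) 1) :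
    drawPoint [] c t ≠ drawPoint (b :: w) c' s := by
  obtain ⟨h1, h2, h3, h4⟩ := drawPoint_bounds w c' hs
  obtain ⟨h5, h6⟩ := ht
  intro h
  rw [drawPoint_cons] at h
  obtain ⟨hx, hy⟩ := Prod.ext_iff.1 h
  rcases c with _ | _ | _
  · rw [drawPoint_nil_none] at hx hy
    cases b <;> simp only [place] at hx hy <;> linarith
  · rw [drawPoint_nil_false] at hx hy
    cases b <;> simp only [place] at hx hy <;> linarith
  · rw [drawPoint_nil_true] at hx hy
    cases b <;> simp only [place] at hx hy <;> linarith

/-- With the parameter zero excluded, each point of the tree other than the root has just one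
address: a vertex counts only as the lower end of the edge above it. The two copies are told apart
by the sign of `y`. -/
lemma drawPoint_injective {w w' : List Bool} {c c' : Option Bool} {t s : ℝ}
    (ht : t ∈ Set.Ioc (0 : ℝ) 1) (hs : s ∈ Set.Ioc (0 : ℝ) 1)
    (h : drawPoint w c t = drawPoint w' c' s) : w = w' ∧ c = c' ∧ t = s := by
  induction w generalizing w' with
  | nil =>
    rcases w' with _ | ⟨b, w'⟩
    · obtain ⟨h5, h6⟩ := ht
      obtain ⟨h7, h8⟩ := hs
      obtain ⟨hx, hy⟩ := Prod.ext_iff.1 h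
      rcases c with _ | _ | _ <;> rcases c' with _ | _ | _ <;>
        simp only [drawPoint_nil_none, drawPoint_nil_false, drawPoint_nil_true] at hx hy
      all_goals first
        | exact ⟨rfl, rfl, by linarith⟩
        | (exfalso; linarith)
    · exact absurd h (drawPoint_nil_ne_cons _ _ _ _ ht hs)
  | cons b w ih =>
    rcases w' with _ | ⟨b', w'⟩
    · exact absurd h.symm (drawPoint_nil_ne_cons _ _ _ _ hs ht)
    · obtain ⟨h1, h2, h3, h4⟩ := drawPoint_bounds w c ht
      obtain ⟨h5, h6, h7, h8⟩ := drawPoint_bounds w' c' hs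
      rw [drawPoint_cons, drawPoint_cons] at h
      obtain rfl : b = b' := by
        have hy := (Prod.ext_iff.1 h).2
        cases b <;> cases b' <;> simp only [place] at hy
        · rfl
        · linarith
        · linarith
        · rfl
      obtain ⟨rfl, rfl, rfl⟩ := ih (place_injective b h)
      exact ⟨rfl, rfl, rfl⟩

lemma exists_edgePoint_eq_of_ne_nil {z : List Bool ⊕ List Bool} (hz : z ≠ .inl []) :
    ∃ w c, lowerEnd w c = z := by
  rcases z with l | l
  · have hl : l ≠ [] := fun h => hz (congrArg _ h)
    exact ⟨l.dropLast, some (l.getLast hl), congrArg Sum.inl (List.dropLast_append_getLast hl)⟩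
  · exact ⟨l, none, rfl⟩

/-- Different points of the abstract tree, the root excluded, have different positions. -/
lemma edgePoint_eq_of_drawPoint_eq {w w' : List Bool} {c c' : Option Bool} {t s : ℝ}
    (ht : t ∈ Set.Icc (0 : ℝ) 1) (hs : s ∈ Set.Icc (0 : ℝ) 1) (hw : w ≠ []) (hw' : w' ≠ [])
    (h : drawPoint w c t = drawPoint w' c' s) :
    edgePoint (.inl w) (lowerEnd w c) t = edgePoint (.inl w') (lowerEnd w' c') s := by
  have key : ∀ (w : List Bool) (c : Option Bool) (t : ℝ), w ≠ [] → t ∈ Set.Icc (0 : ℝ) 1 →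
      ∃ w₁ c₁, ∃ t₁ ∈ Set.Ioc (0 : ℝ) 1, drawPoint w c t = drawPoint w₁ c₁ t₁ ∧
        edgePoint (.inl w) (lowerEnd w c) t = edgePoint (.inl w₁) (lowerEnd w₁ c₁) t₁ := by
    intro w c t hw ht
    rcases ht.1.eq_or_lt with rfl | h
    · obtain ⟨w₁, c₁, h1⟩ := exists_edgePoint_eq_of_ne_nil (z := .inl w) (by simpa using hw)
      refine ⟨w₁, c₁, 1, by simp, ?_, ?_⟩
      · simp [drawPoint, h1, position']
      · rw [edgePoint_zero, edgePoint_one, h1]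
    · exact ⟨w, c, t, ⟨h, ht.2⟩, rfl, rfl⟩
  obtain ⟨w₁, c₁, t₁, ht₁, e1, e2⟩ := key w c t hw ht
  obtain ⟨w₂, c₂, t₂, ht₂, e3, e4⟩ := key w' c' s hw' hs
  rw [e2, e4]
  obtain ⟨rfl, rfl, rfl⟩ := drawPoint_injective ht₁ ht₂ (e1.symm.trans (h.trans e3))
  rfl

open FinGraph in
/-- The graphs `R n` are drawn without crossings in the drawings of the binary tree. -/
lemma exists_embedding_R_drawing (n : ℕ) (hn : 1 ≤ n) :
    ∃ (m : ℕ) (φ : (R n).Space → ℝ × ℝ), Continuous φ ∧ Function.Injective φ ∧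
      ∀ x, φ x ∈ drawing m := by
  classical
  obtain ⟨n, rfl⟩ := Nat.exists_eq_add_of_le' hn
  have hfin : Finite (F (n + 1)).V := FinGraph.fin _
  have hfinR : Finite (R (n + 1)).V := FinGraph.fin _
  have hne : Nonempty (F (n + 1)).V := by
    clear hn hfin hfinR
    induction n with
    | zero => exact ⟨.inl ()⟩
    | succ n ih => exact ih.map (FInl n)
  obtain ⟨ρ, hρ⟩ := exists_isRank_F n
  obtain ⟨f, hf⟩ := exists_embedding_binaryTree (T := (F (n + 1)).graph)
    ⟨(SimpleGraph.connected_iff _).2 ⟨preconnected_F n, hne⟩, hρ.isAcyclic⟩ (fun v => by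
      rcases deg_F n v with h | h <;> rw [deg] at h <;> omega)
  let g : (R (n + 1)).V → List Bool ⊕ List Bool := Sum.elim (fun v => .inl (f v))
    fun w => .inr (f w.1)
  have hg : Function.Injective g := by
    rintro (u | ⟨u, i⟩) (v | ⟨v, j⟩) h
    · exact congrArg _ (f.injective (Sum.inl_injective h))
    · exact absurd h Sum.inl_ne_inr
    · exact absurd h Sum.inr_ne_inl
    · obtain rfl : u = v := f.injective (Sum.inr_injective h)
      -- At most one hanging edge is attached at each vertex.
      have : i = j := by
        have hi := i.2
        have hj := j.2
        beta_reduce at hi hj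
        exact Fin.ext (by split_ifs at hi hj <;> omega)
      rw [this]
  have hadj : ∀ u v, (R (n + 1)).graph.Adj u v →
      (∃ w c, g u = .inl (f w) ∧ g v = lowerEnd (f w) c) ∨
        ∃ w c, g v = .inl (f w) ∧ g u = lowerEnd (f w) c := by
    rintro (u | u) (v | v) h
    · rcases f.map_adj_iff.2 h with ⟨b, hb⟩ | ⟨b, hb⟩
      · exact Or.inl ⟨u, some b, rfl, congrArg Sum.inl hb⟩
      · exact Or.inr ⟨v, some b, rfl, congrArg Sum.inl hb⟩
    · obtain rfl : u = v.1 := h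
      exact Or.inl ⟨v.1, none, rfl, rfl⟩
    · obtain rfl : v = u.1 := h
      exact Or.inr ⟨u.1, none, rfl, rfl⟩
    · exact h.elim
  have hvert : ∀ v, (∃ w, g v = .inl (f w)) ∨ ∃ w, g v = .inr (f w) := by
    rintro (v | v)
    · exact Or.inl ⟨v, rfl⟩
    · exact Or.inr ⟨v.1, rfl⟩
  have := Fintype.ofFinite (R (n + 1)).V
  -- The positions are extended linearly, and `pushPoint g` records the same point in the abstract
  -- tree, where it is determined by its image in the plane.
  let Φ : ((R (n + 1)).V → ℝ) → ℝ × ℝ := fun x => ∑ v, x v • position' (g v)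
  have hΦ : ∀ u v t, Φ (edgePoint u v t) = (1 - t) • position' (g u) + t • position' (g v) := by
    intro u v t
    simp [Φ, edgePoint, vertexPoint_apply, add_smul, Finset.sum_add_distrib]
  have hΦv : ∀ v, Φ (vertexPoint v) = position' (g v) := fun v => by
    simp [Φ, vertexPoint_apply]
  have hrep : ∀ x : (R (n + 1)).Space, ∃ v c, ∃ t ∈ Set.Icc (0 : ℝ) 1,
      Φ x = drawPoint (f v) c t ∧
        pushPoint g x = edgePoint (.inl (f v)) (lowerEnd (f v) c) t := by
    rintro ⟨x, hx⟩
    simp only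
    rcases mem_carrier_iff.1 hx with ⟨v, -, rfl⟩ | ⟨u, v, h, t, ht, rfl⟩
    · rw [hΦv, pushPoint_vertexPoint hg]
      rcases hvert v with ⟨w, hw⟩ | ⟨w, hw⟩
      · refine ⟨w, none, 0, by simp, ?_, ?_⟩
        · simp [drawPoint, position', hw]
        · rw [edgePoint_zero, hw]
      · refine ⟨w, none, 1, by simp, ?_, ?_⟩
        · simp [drawPoint, position', lowerEnd, hw]
        · rw [edgePoint_one, hw]
          rfl
    · rw [hΦ, pushPoint_edgePoint hg]
      rcases hadj u v h with ⟨w, c, h1, h2⟩ | ⟨w, c, h1, h2⟩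
      · refine ⟨w, c, t, ht, ?_, ?_⟩
        · rw [h1, h2]
          rfl
        · rw [h1, h2]
      · refine ⟨w, c, 1 - t, ⟨by linarith [ht.2], by linarith [ht.1]⟩, ?_, ?_⟩
        · rw [h1, h2, add_comm, drawPoint, sub_sub_cancel]
          rfl
        · rw [h1, h2, edgePoint_symm]
  obtain ⟨m, hm⟩ := (Set.finite_range fun v => (f v).length).bddAbove
  refine ⟨m + 1, fun x => Φ x, ?_, ?_, ?_⟩
  · have : Continuous Φ := by fun_prop
    exact this.comp continuous_subtype_val
  · intro x y hxy
    obtain ⟨v, c, t, ht, h1, h2⟩ := hrep x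
    obtain ⟨w, d, s, hs, h3, h4⟩ := hrep y
    have h5 := edgePoint_eq_of_drawPoint_eq ht hs (hf v) (hf w) (h1.symm.trans (hxy.trans h3))
    rw [← h2, ← h4] at h5
    ext u
    rw [← pushPoint_apply hg x.1, h5, pushPoint_apply hg]
  · intro x
    obtain ⟨v, c, t, ht, h1, -⟩ := hrep x
    simp only
    rw [h1]
    exact drawPoint_mem_drawing _ (Nat.lt_succ_of_le (hm ⟨v, rfl⟩)) c ht

lemma IsFiniteGraph.compactSpace {K : Type*} [TopologicalSpace K] (hK : IsFiniteGraph K) :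
    CompactSpace K := by
  obtain ⟨n, G, ⟨e⟩⟩ := hK
  exact e.symm.compactSpace

lemma basicallyEmbeddable_of_isContainedIn_R {K : Type*} [TopologicalSpace K] [CompactSpace K]
    {n : ℕ} (hn : 1 ≤ n) (h : IsContainedIn K (FinGraph.R n).Space) : BasicallyEmbeddable K := by
  obtain ⟨i, hi⟩ := h
  obtain ⟨m, φ, hφ, hφi, hφm⟩ := exists_embedding_R_drawing n hn
  have hc := (hφ.comp hi.continuous).isClosedEmbedding (hφi.comp hi.injective)
  refine ⟨φ ∘ i, hc.isEmbedding, (isBasic_drawing m).mono hc.isClosed_range ?_⟩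
  rintro _ ⟨x, rfl⟩
  exact hφm _

end BinaryTree

/-! ### The incidence graph of a plane set -/

section Incidence

/-- The coordinate functions of the plane. -/
def coord (c : Bool) (p : ℝ × ℝ) : ℝ := if c then p.2 else p.1

lemma continuous_coord (c : Bool) : Continuous (coord c) := by
  cases c
  · exact continuous_fst
  · exact continuous_snd

lemma ext_coord {p q : ℝ × ℝ} (c : Bool) (h : coord c p = coord c q)
    (h' : coord (!c) p = coord (!c) q) : p = q := by
  cases c
  · exact Prod.ext h h'
  · exact Prod.ext h' h

/-- The line of the given direction through a point. -/
def line (c : Bool) (p : ℝ × ℝ) : Bool × ℝ := (c, coord c p)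

lemma line_eq_iff {c d : Bool} {p q : ℝ × ℝ} :
    line c p = line d q ↔ c = d ∧ coord c p = coord d q := by
  simp [line]

lemma line_not_ne (c : Bool) (p q : ℝ × ℝ) : line (!c) p ≠ line c q := by
  simp [line]

/-- The bipartite graph whose vertices are the lines parallel to the axes and whose edges are the
points of `S`. -/
def incidence (S : Set (ℝ × ℝ)) : SimpleGraph (Bool × ℝ) where
  Adj a b := ∃ p ∈ S, ∃ c, a = line c p ∧ b = line (!c) p
  symm := ⟨fun a b ⟨p, hp, c, h1, h2⟩ => ⟨p, hp, !c, h2, by rw [Bool.not_not]; exact h1⟩⟩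
  loopless := ⟨fun a ⟨p, _, c, h1, h2⟩ => line_not_ne c p p (h2.symm.trans h1)⟩

lemma incidence_adj {S : Set (ℝ × ℝ)} {p : ℝ × ℝ} (hp : p ∈ S) (c : Bool) :
    (incidence S).Adj (line c p) (line (!c) p) := ⟨p, hp, c, rfl, rfl⟩

lemma incidence_adj' {S : Set (ℝ × ℝ)} {p : ℝ × ℝ} (hp : p ∈ S) (c : Bool) :
    (incidence S).Adj (line (!c) p) (line c p) := (incidence_adj hp c).symm

lemma incidence_mono {S T : Set (ℝ × ℝ)} (h : S ⊆ T) : incidence S ≤ incidence T :=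
  fun _ _ ⟨p, hp, hc⟩ => ⟨p, h hp, hc⟩

/-- The potential of a pair of functions of one variable. -/
def potential (g h : ℝ → ℝ) (a : Bool × ℝ) : ℝ := if a.1 then -h a.2 else g a.2

/-- As `h` enters the potential negatively, the sum at a point becomes the increment along the
corresponding edge. -/
lemma potential_line (g h : ℝ → ℝ) (p : ℝ × ℝ) :
    potential g h (line false p) - potential g h (line true p) = g p.1 + h p.2 := by
  simp [potential, line, coord]

lemma potential_line_sub (g h : ℝ → ℝ) (p : ℝ × ℝ) (c : Bool) :
    potential g h (line (!c) p) - potential g h (line c p) =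
      (if c then 1 else -1) * (g p.1 + h p.2) := by
  rw [← potential_line g h p]
  cases c <;> simp

lemma exists_finite_reachable {S : Set (ℝ × ℝ)} {a b : Bool × ℝ}
    (h : (incidence S).Reachable a b) :
    ∃ Q ⊆ S, Q.Finite ∧ (incidence Q).Reachable a b := by
  obtain ⟨w⟩ := h
  induction w with
  | nil => exact ⟨∅, Set.empty_subset _, Set.finite_empty, SimpleGraph.Reachable.refl _⟩
  | cons hadj w ih =>
    obtain ⟨Q, hQS, hQ, hr⟩ := ih
    obtain ⟨p, hp, c, rfl, rfl⟩ := hadj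
    refine ⟨insert p Q, Set.insert_subset hp hQS, hQ.insert p, ?_⟩
    exact (incidence_adj (Set.mem_insert p Q) c).reachable.trans
      (hr.mono (incidence_mono (Set.subset_insert p Q)))

/-- Every point of a basic set is a bridge of the incidence graph. -/
lemma IsBasic.not_reachable {K : Set (ℝ × ℝ)} (hK : IsBasic K) {p : ℝ × ℝ} (hp : p ∈ K) :
    ¬ (incidence (K \ {p})).Reachable (line false p) (line true p) := by
  intro h
  -- If `f` is `0` on the finite connection `Q` and `1` at `p`, the potential is constant along `Q`
  -- but has a jump at `p`.
  obtain ⟨Q, hQS, hQ, hr⟩ := exists_finite_reachable h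
  obtain ⟨f, hf0, hf1, -⟩ := exists_continuous_zero_one_of_isClosed hQ.isClosed
    (isClosed_singleton (x := p)) (Set.disjoint_singleton_right.2 fun h => (hQS h).2 rfl)
  obtain ⟨g, k, -, -, e⟩ := isBasic_iff.1 hK f f.continuous.continuousOn
  have key : ∀ {a b}, (incidence Q).Reachable a b → potential g k a = potential g k b := by
    rintro a b ⟨w⟩
    induction w with
    | nil => rfl
    | cons hadj w ih =>
      obtain ⟨q, hq, c, rfl, rfl⟩ := hadj
      rw [← ih, eq_comm, ← sub_eq_zero, potential_line_sub, ← e q (hQS hq).1, hf0 hq]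
      simp
  have h1 := potential_line g k p
  rw [key hr, sub_self, ← e p hp, hf1 rfl] at h1
  exact zero_ne_one h1

lemma IsBasic.isAcyclic_incidence {K : Set (ℝ × ℝ)} (hK : IsBasic K) :
    (incidence K).IsAcyclic := by
  rw [SimpleGraph.isAcyclic_iff_forall_adj_isBridge]
  rintro a b ⟨p, hp, c, rfl, rfl⟩
  rw [SimpleGraph.isBridge_iff]
  intro h
  have hle : (incidence K).deleteEdges {s(line c p, line (!c) p)} ≤ incidence (K \ {p}) := by
    rintro a b hab
    rw [SimpleGraph.deleteEdges_adj] at hab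
    obtain ⟨⟨q, hq, d, rfl, rfl⟩, hne⟩ := hab
    refine ⟨q, ⟨hq, ?_⟩, d, rfl, rfl⟩
    rintro rfl
    refine hne ?_
    rw [Set.mem_singleton_iff]
    cases c <;> cases d <;> first | rfl | exact Sym2.eq_swap
  have h1 := h.mono hle
  cases c
  · exact hK.not_reachable hp h1
  · exact hK.not_reachable hp h1.symm

/-- The signs follow the direction in which the edges are crossed, so that the potential rises by
one at each step. On a path the edges are distinct, and the signs can be chosen independently. -/
lemma exists_sign_of_isPath {K : Set (ℝ × ℝ)} {a b : Bool × ℝ} (w : (incidence K).Walk a b)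
    (hw : w.IsPath) : ∃ (Q : Set (ℝ × ℝ)) (σ : ℝ × ℝ → ℝ), Q.Finite ∧ Q ⊆ K ∧
      (∀ p ∈ Q, ∀ c, line c p ∈ w.support) ∧ (∀ p, |σ p| ≤ 1) ∧
      ∀ g h : ℝ → ℝ, (∀ p ∈ Q, σ p = g p.1 + h p.2) →
        potential g h b - potential g h a = w.length := by
  classical
  induction w with
  | nil => exact ⟨∅, 0, Set.finite_empty, by simp, by simp, by simp, by simp⟩
  | cons hadj w ih =>
    rw [SimpleGraph.Walk.cons_isPath_iff] at hw
    obtain ⟨Q, σ, hQ, hQK, hQs, hσ, hgh⟩ := ih hw.1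
    obtain ⟨p, hp, c, rfl, rfl⟩ := hadj
    have hpQ : p ∉ Q := fun h => hw.2 (hQs p h c)
    refine ⟨insert p Q, Function.update σ p (if c then 1 else -1), hQ.insert p,
      Set.insert_subset hp hQK, ?_, ?_, ?_⟩
    · rintro q (rfl | hq) d
      · refine List.mem_cons.2 ?_
        by_cases hd : d = c
        · exact Or.inl (by rw [hd])
        · right
          have : d = !c := by cases c <;> cases d <;> simp_all
          rw [this]
          exact w.start_mem_support
      · exact List.mem_cons_of_mem _ (hQs q hq d)
    · intro q
      by_cases hq : q = p
      · subst hq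
        rw [Function.update_self]
        split_ifs <;> simp
      · rw [Function.update_of_ne hq]
        exact hσ q
    · intro g h hgh'
      have h1 := hgh g h fun q hq => by
        rw [← hgh' q (Set.mem_insert_of_mem p hq), Function.update_of_ne]
        rintro rfl
        exact hpQ hq
      have h2 := potential_line_sub g h p c
      rw [← hgh' p (Set.mem_insert p Q), Function.update_self] at h2
      have h3 : ((if c then 1 else -1) * (if c then 1 else -1) : ℝ) = 1 := by
        split_ifs <;> norm_num
      rw [h3] at h2
      change _ = ((w.length + 1 : ℕ) : ℝ)
      push_cast
      linarith

open BoundedContinuousFunction in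
/-- On a compact basic set the summands can be chosen bounded in terms of the given function. -/
lemma IsBasic.exists_bound {K : Set (ℝ × ℝ)} (hK : IsBasic K) (hKc : IsCompact K) :
    ∃ C : ℝ, ∀ f : ℝ × ℝ → ℝ, Continuous f → (∀ p, |f p| ≤ 1) →
      ∃ g h : ℝ → ℝ, (∀ x, |g x| ≤ C) ∧ (∀ x, |h x| ≤ C) ∧ ∀ p ∈ K, f p = g p.1 + h p.2 := by
  -- The open mapping theorem applies to the operator that sends a pair of bounded functions to its
  -- sum on `K`. It is surjective because the summands can be truncated at their bounds on the
  -- compact projections.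
  let L : ((ℝ →ᵇ ℝ) × (ℝ →ᵇ ℝ)) →ₗ[ℝ] (K →ᵇ ℝ) :=
    { toFun := fun u => u.1.compContinuous ⟨fun p : K => p.1.1, by fun_prop⟩ +
        u.2.compContinuous ⟨fun p : K => p.1.2, by fun_prop⟩
      map_add' := fun u v => by
        ext p
        simp [add_add_add_comm]
      map_smul' := fun r u => by
        ext p
        simp }
  have hL : ∀ u p, L u p = u.1 p.1.1 + u.2 p.1.2 := fun u p => rfl
  let T : ((ℝ →ᵇ ℝ) × (ℝ →ᵇ ℝ)) →L[ℝ] (K →ᵇ ℝ) := L.mkContinuous 2 (by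
    intro u
    rw [BoundedContinuousFunction.norm_le (by positivity)]
    intro p
    rw [hL]
    have h1 := (u.1.norm_coe_le_norm p.1.1).trans (norm_fst_le u)
    have h2 := (u.2.norm_coe_le_norm p.1.2).trans (norm_snd_le u)
    exact (norm_add_le _ _).trans (by linarith))
  have clamp : ∀ {C : Set ℝ}, IsCompact C → ∀ {g : ℝ → ℝ}, Continuous g →
      ∃ g' : ℝ →ᵇ ℝ, ∀ x ∈ C, g' x = g x := by
    intro C hC g hg
    obtain ⟨B, hB⟩ := hC.exists_bound_of_continuousOn hg.continuousOn
    refine ⟨BoundedContinuousFunction.ofNormedAddCommGroup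
      (fun x => max (-|B|) (min |B| (g x))) (by fun_prop) |B| fun x => ?_, fun x hx => ?_⟩
    · rw [Real.norm_eq_abs, abs_le]
      exact ⟨le_max_left _ _, max_le (by linarith [abs_nonneg B]) (min_le_left _ _)⟩
    · have := abs_le.1 ((hB x hx).trans (le_abs_self B))
      change max (-|B|) (min |B| (g x)) = g x
      rw [min_eq_right this.2, max_eq_right this.1]
  have hsurj : Function.Surjective T := by
    intro f
    obtain ⟨g, h, hg, hh, e⟩ := hK f f.continuous
    obtain ⟨g', hg'⟩ := clamp (hKc.image continuous_fst) hg
    obtain ⟨h', hh'⟩ := clamp (hKc.image continuous_snd) hh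
    refine ⟨(g', h'), ?_⟩
    ext p
    change g' p.1.1 + h' p.1.2 = f p
    rw [e p, hg' _ ⟨p, p.2, rfl⟩, hh' _ ⟨p, p.2, rfl⟩]
  obtain ⟨C, hC, H⟩ := T.exists_preimage_norm_le hsurj
  refine ⟨C, fun f hf hf1 => ?_⟩
  let f' : K →ᵇ ℝ := BoundedContinuousFunction.ofNormedAddCommGroup (fun p : K => f p)
    (hf.comp continuous_subtype_val) 1 fun p => hf1 p
  have hf' : ‖f'‖ ≤ 1 := BoundedContinuousFunction.norm_ofNormedAddCommGroup_le _ zero_le_one _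
  obtain ⟨u, hu, hun⟩ := H f'
  have hun' : ‖u‖ ≤ C := hun.trans (mul_le_of_le_one_right hC.le hf')
  refine ⟨u.1, u.2, fun x => ?_, fun x => ?_, fun p hp => ?_⟩
  · exact (u.1.norm_coe_le_norm x).trans ((norm_fst_le u).trans hun')
  · exact (u.2.norm_coe_le_norm x).trans ((norm_snd_le u).trans hun')
  · exact (DFunLike.congr_fun hu ⟨p, hp⟩).symm

/-- The paths of the incidence graph of a compact basic set have bounded lengths. -/
lemma IsBasic.exists_length_le {K : Set (ℝ × ℝ)} (hK : IsBasic K) (hKc : IsCompact K) :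
    ∃ N : ℕ, ∀ {a b : Bool × ℝ} (w : (incidence K).Walk a b), w.IsPath → w.length ≤ N := by
  obtain ⟨C, hC⟩ := hK.exists_bound hKc
  -- The potential stays between `-C` and `C` and rises by one at each step of the path.
  refine ⟨⌊2 * C⌋₊, fun {a b} w hw => ?_⟩
  obtain ⟨Q, σ, hQ, hQK, -, hσ, hgh⟩ := exists_sign_of_isPath w hw
  have hcont : ContinuousOn σ Q := hQ.continuousOn σ
  obtain ⟨v, hv, hvσ⟩ := exists_continuous_eqOn hQ.isClosed hcont
  obtain ⟨g, h, hg, hh, e⟩ := hC (fun p => max (-1) (min 1 (v p))) (by fun_prop) fun p => by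
    rw [abs_le]
    exact ⟨le_max_left _ _, max_le (by norm_num) (min_le_left _ _)⟩
  have h1 := hgh g h fun p hp => by
    have := abs_le.1 (hσ p)
    rw [← e p (hQK hp), hvσ p hp, min_eq_right this.2, max_eq_right this.1]
  have h2 : ∀ a, |potential g h a| ≤ C := by
    intro a
    unfold potential
    split_ifs
    · rw [abs_neg]
      exact hh _
    · exact hg _
  apply Nat.le_floor
  have h3 := abs_le.1 (h2 a)
  have h4 := abs_le.1 (h2 b)
  linarith [h3.1, h4.2]

lemma reachable_of_line_notMem_support {K : Set (ℝ × ℝ)} {a b : Bool × ℝ}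
    (w : (incidence K).Walk a b) {p : ℝ × ℝ} {c : Bool} (hp : line c p ∉ w.support) :
    (incidence (K \ {p})).Reachable a b := by
  induction w with
  | nil => exact SimpleGraph.Reachable.refl _
  | cons hadj w ih =>
    rw [SimpleGraph.Walk.support_cons, List.mem_cons, not_or] at hp
    obtain ⟨q, hq, d, rfl, rfl⟩ := hadj
    have hqp : q ≠ p := by
      rintro rfl
      by_cases hd : c = d
      · exact hp.1 (by rw [hd])
      · have : c = !d := by cases c <;> cases d <;> simp_all
        exact hp.2 (by rw [this]; exact w.start_mem_support)
    exact (incidence_adj (S := K \ {p}) ⟨hq, hqp⟩ d).reachable.trans (ih hp.2)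

/-- A compact basic set contains no points from which one can walk arbitrarily far, alternately
in the directions of the two axes, unless one reaches a connected set of lines. -/
lemma IsBasic.false_of_walks {K W : Set (ℝ × ℝ)} (hK : IsBasic K) (hKc : IsCompact K)
    (hWK : W ⊆ K) {D : Set (Bool × ℝ)}
    (hD : ∀ a ∈ D, ∀ b ∈ D, (incidence W).Reachable a b) {Z : ℕ → Set (ℝ × ℝ)}
    (hZ : ∀ n, Z n ⊆ K \ W) (hne : ∀ n, (Z n).Nonempty)
    (hstep : ∀ n, ∀ p ∈ Z (n + 1), ∀ c,
      line c p ∈ D ∨ ∃ q ∈ Z n, q ≠ p ∧ coord c q = coord c p) : False := by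
  have hac := hK.isAcyclic_incidence
  obtain ⟨N, hN⟩ := hK.exists_length_le hKc
  have claim : ∀ n, ∀ p (hp : p ∈ Z n) (c : Bool), ∃ v, ∃ w : (incidence K).Walk (line c p) v,
      (SimpleGraph.Walk.cons (incidence_adj' (hZ n hp).1 c) w).IsPath ∧
        (n ≤ w.length ∨ v ∈ D) := by
    intro n
    induction n with
    | zero =>
      intro p hp c
      refine ⟨_, .nil, ?_, Or.inl le_rfl⟩
      simp [SimpleGraph.Walk.cons_isPath_iff, line_not_ne]
    | succ n ih =>
      intro p hp c
      rcases hstep n p hp c with h | ⟨q, hq, hqp, hc⟩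
      · refine ⟨_, .nil, ?_, Or.inr h⟩
        simp [SimpleGraph.Walk.cons_isPath_iff, line_not_ne]
      · obtain ⟨v, w, hw, hl⟩ := ih q hq (!c)
        have hadj : (incidence K).Adj (line c p) (line (!c) q) := by
          have : line c p = line c q := by rw [line, line, hc]
          rw [this]
          exact incidence_adj (hZ n hq).1 c
        have hw1 := (SimpleGraph.Walk.cons_isPath_iff _ _).1 hw
        have hw' : (SimpleGraph.Walk.cons hadj w).IsPath := by
          rw [SimpleGraph.Walk.cons_isPath_iff]
          refine ⟨hw1.1, ?_⟩
          have h2 := hw1.2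
          rw [Bool.not_not] at h2
          have h3 : line c p = line c q := by rw [line, line, hc]
          rwa [h3]
        refine ⟨v, .cons hadj w, ?_, hl.imp (fun h => by simpa using h) id⟩
        rw [SimpleGraph.Walk.cons_isPath_iff]
        refine ⟨hw', fun hmem => hqp ?_⟩
        -- If the other line through `p` were on the path, acyclicity would make it the second
        -- vertex, whence `q = p`.
        have h3 := hac.eq_snd_of_adj_start hw' (incidence_adj (hZ _ hp).1 c) hmem
        rw [SimpleGraph.Walk.snd_cons, line_eq_iff] at h3
        exact ext_coord c hc h3.2.symm
  -- At this stage both walks from `p` would be too long unless they end in `D`; a connection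
  -- through `W` then closes a cycle through `p`.
  obtain ⟨p, hp⟩ := hne (N + 1)
  have hend : ∀ c, ∃ v ∈ D, (incidence (K \ {p})).Reachable (line c p) v := by
    intro c
    obtain ⟨v, w, hw, hl⟩ := claim _ p hp c
    have h1 := hN _ hw
    rw [SimpleGraph.Walk.length_cons] at h1
    refine ⟨v, hl.resolve_left (by omega), ?_⟩
    exact reachable_of_line_notMem_support w ((SimpleGraph.Walk.cons_isPath_iff _ _).1 hw).2
  obtain ⟨v, hv, h1⟩ := hend false
  obtain ⟨u, hu, h2⟩ := hend true
  have hW : W ⊆ K \ {p} := fun q hq => ⟨hWK hq, fun h => (hZ _ hp).2 (h ▸ hq)⟩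
  exact hK.not_reachable (hZ _ hp).1
    ((h1.trans ((hD v hv u hu).mono (incidence_mono hW))).trans h2.symm)

end Incidence

/-! ### Obstructions to being basic -/

section Obstruction

/-- A compact basic set that no point disconnects is finite. -/
lemma IsBasic.finite_of_isPreconnected {K : Set (ℝ × ℝ)} (hK : IsBasic K) (hKc : IsCompact K)
    (hc : ∀ p ∈ K, IsPreconnected (K \ {p})) : K.Finite := by
  by_contra hinf
  -- These are the points left without a partner once `F` is removed. Such a point shares its line
  -- with a point of `F`, or it is the strict maximum or minimum of the coordinate, since the rest
  -- of `K` projects onto an interval missing its value. So there are finitely many.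
  let U : Set (ℝ × ℝ) → Bool → Set (ℝ × ℝ) := fun F c =>
    {p | p ∈ K \ F ∧ ∀ q ∈ K \ F, coord c q = coord c p → q = p}
  have hU : ∀ F : Set (ℝ × ℝ), F.Finite → ∀ c, (U F c).Finite := by
    intro F hF c
    have h1 : (U F c ∩ coord c ⁻¹' (coord c '' F)).Finite := by
      refine Set.Finite.of_finite_image ((hF.image (coord c)).subset
        (Set.image_subset_iff.2 Set.inter_subset_right)) ?_
      intro p hp q hq h
      exact hq.1.2 p hp.1.1 h
    have h2 : {p | p ∈ K ∧ ∀ q ∈ K, q ≠ p → coord c q < coord c p}.Subsingleton := by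
      rintro p ⟨hp, hp'⟩ q ⟨hq, hq'⟩
      by_contra hpq
      exact lt_asymm (hq' p hp hpq) (hp' q hq (Ne.symm hpq))
    have h3 : {p | p ∈ K ∧ ∀ q ∈ K, q ≠ p → coord c p < coord c q}.Subsingleton := by
      rintro p ⟨hp, hp'⟩ q ⟨hq, hq'⟩
      by_contra hpq
      exact lt_asymm (hq' p hp hpq) (hp' q hq (Ne.symm hpq))
    refine ((h1.union h2.finite).union h3.finite).subset ?_
    rintro p ⟨hp, hpu⟩
    by_cases hpF : coord c p ∈ coord c '' F
    · exact Or.inl (Or.inl ⟨⟨hp, hpu⟩, hpF⟩)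
    have hne : ∀ q ∈ K \ {p}, coord c q ≠ coord c p := by
      rintro q ⟨hq, hqp⟩ h
      exact hqp (hpu q ⟨hq, fun hqF => hpF ⟨q, hqF, h⟩⟩ h)
    have hpre : (coord c '' (K \ {p})).OrdConnected :=
      ((hc p hp.1).image _ (continuous_coord c).continuousOn).ordConnected
    by_cases hlt : ∃ q ∈ K \ {p}, coord c q < coord c p
    · obtain ⟨q, hq, hqp⟩ := hlt
      refine Or.inl (Or.inr ⟨hp.1, fun r hr hrp => ?_⟩)
      refine lt_of_le_of_ne (not_lt.1 fun h => ?_) (hne r ⟨hr, hrp⟩)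
      obtain ⟨z, hz, hzp⟩ := hpre.out ⟨q, hq, rfl⟩ ⟨r, ⟨hr, hrp⟩, rfl⟩ ⟨hqp.le, h.le⟩
      exact hne z hz hzp
    · push Not at hlt
      exact Or.inr ⟨hp.1, fun r hr hrp =>
        lt_of_le_of_ne (hlt r ⟨hr, hrp⟩) (hne r ⟨hr, hrp⟩).symm⟩
  -- Points without a partner are removed repeatedly; what remains is always infinite.
  let F : ℕ → Set (ℝ × ℝ) := fun n => n.rec ∅ fun _ F => F ∪ (U F false ∪ U F true)
  have hF : ∀ n, (F n).Finite := by
    intro n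
    induction n with
    | zero => exact Set.finite_empty
    | succ n ih => exact ih.union ((hU _ ih _).union (hU _ ih _))
  refine hK.false_of_walks hKc (Set.empty_subset K) (D := ∅) (by simp) (Z := fun n => K \ F n)
    (fun n p hp => ⟨hp.1, Set.notMem_empty p⟩)
    (fun n => (Set.Infinite.sdiff hinf (hF n)).nonempty) ?_
  rintro n p ⟨hp, hpF⟩ c
  right
  by_contra hq
  push Not at hq
  have h1 : p ∉ F n := fun h => hpF (Or.inl h)
  have h2 : p ∈ U (F n) c := ⟨⟨hp, h1⟩, fun q hqK h => by
    by_contra hne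
    exact hq q hqK hne h⟩
  refine hpF (Or.inr ?_)
  cases c
  · exact Or.inl h2
  · exact Or.inr h2

/-- Removing a member with a private element shrinks the union, and the last remaining set still has
`k` elements. -/
lemma card_add_le_card_biUnion {ι τ : Type*} [DecidableEq ι] [DecidableEq τ] {T : ι → Finset τ}
    {k : ℕ} (hT : ∀ i, k ≤ (T i).card)
    (h : ∀ M : Finset ι, M.Nonempty → ∃ i ∈ M, ∃ x ∈ T i, ∀ j ∈ M, j ≠ i → x ∉ T j)
    (M : Finset ι) (hM : M.Nonempty) : M.card + k ≤ (M.biUnion T).card + 1 := by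
  induction M using Finset.strongInduction with
  | H M ih =>
    obtain ⟨i, hi, x, hx, hxj⟩ := h M hM
    have hcard := Finset.card_erase_add_one hi
    rcases (M.erase i).eq_empty_or_nonempty with h0 | hne
    · rw [h0, Finset.card_empty] at hcard
      have := Finset.card_le_card (Finset.subset_biUnion_of_mem T hi)
      have := hT i
      omega
    · have h1 := ih _ (Finset.erase_ssubset hi) hne
      have h2 : x ∉ (M.erase i).biUnion T := by
        rw [Finset.mem_biUnion]
        rintro ⟨j, hj, hxT⟩
        exact hxj j (Finset.mem_of_mem_erase hj) (Finset.ne_of_mem_erase hj) hxT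
      have h3 : insert x ((M.erase i).biUnion T) ⊆ M.biUnion T := by
        refine Finset.insert_subset (Finset.mem_biUnion.2 ⟨i, hi, hx⟩) ?_
        exact Finset.biUnion_subset_biUnion_of_subset_left T (Finset.erase_subset i M)
      have h4 := Finset.card_le_card h3
      rw [Finset.card_insert_of_notMem h2] at h4
      omega

/-- Signed distance, on one side, of a coordinate from an interval. -/
def excess (lo hi : Bool → ℝ) (x : Bool × Bool) (p : ℝ × ℝ) : ℝ :=
  if x.2 then coord x.1 p - hi x.1 else lo x.1 - coord x.1 p

variable {lo hi : Bool → ℝ}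

lemma continuous_excess (x : Bool × Bool) : Continuous (excess lo hi x) := by
  have := continuous_coord x.1
  unfold excess
  split_ifs <;> fun_prop

lemma excess_nonpos {x : Bool × Bool} {p : ℝ × ℝ} (h : coord x.1 p ∈ Set.Icc (lo x.1) (hi x.1)) :
    excess lo hi x p ≤ 0 := by
  unfold excess
  split_ifs
  · linarith [h.2]
  · linarith [h.1]

lemma exists_excess_pos {c : Bool} {p : ℝ × ℝ} (h : coord c p ∉ Set.Icc (lo c) (hi c)) :
    ∃ s, 0 < excess lo hi (c, s) p := by
  rw [Set.mem_Icc, not_and_or, not_le, not_le] at h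
  rcases h with h | h
  · exact ⟨false, by simp [excess, h]⟩
  · exact ⟨true, by simp [excess, h]⟩

lemma coord_eq_of_excess_eq {x : Bool × Bool} {p q : ℝ × ℝ}
    (h : excess lo hi x p = excess lo hi x q) : coord x.1 p = coord x.1 q := by
  unfold excess at h
  split_ifs at h <;> linarith

/-- At most four disjoint germs of curves may leave a connected set of lines of a compact basic
set, and at most three germs may leave it in both directions. -/
lemma IsBasic.card_germs_le {K W : Set (ℝ × ℝ)} (hK : IsBasic K) (hKc : IsCompact K)
    (hWK : W ⊆ K) {D : Set (Bool × ℝ)} (hD : ∀ a ∈ D, ∀ b ∈ D, (incidence W).Reachable a b)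
    (hWD : ∀ p ∈ W, ∀ c, line c p ∈ D) (hI : ∀ c, ∀ x ∈ Set.Icc (lo c) (hi c), (c, x) ∈ D)
    {ι : Type*} [Fintype ι] {δ : ι → ℝ → ℝ × ℝ} (hδ : ∀ i, Continuous (δ i))
    (hδK : ∀ i t, δ i t ∈ K) (hδ0 : ∀ i c, coord c (δ i 0) ∈ Set.Icc (lo c) (hi c))
    {η : ℝ} (hη : 0 < η)
    (hdisj : ∀ i j, i ≠ j → ∀ t ∈ Set.Ioo 0 η, ∀ s ∈ Set.Ioo 0 η, δ i t ≠ δ j s)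
    (hδW : ∀ i, ∃ᶠ t in 𝓝[>] 0, δ i t ∉ W) :
    Fintype.card ι ≤ 4 ∧
      ((∀ i, ∃ᶠ t in 𝓝[>] 0, ∀ c, line c (δ i t) ∉ D) → Fintype.card ι ≤ 3) := by
  classical
  -- Here `x` is one of the four sides of the box, and `T i` collects the sides beyond which the
  -- germ `i` appears, on lines outside `D`, at arbitrarily small parameters.
  let P : ι → Bool × Bool → ℝ → Prop := fun i x t =>
    line x.1 (δ i t) ∉ D ∧ 0 < excess lo hi x (δ i t)
  have hP : ∀ i c t, line c (δ i t) ∉ D → ∃ s, P i (c, s) t := fun i c t h =>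
    (exists_excess_pos fun h' => h (hI c _ h')).imp fun s hs => ⟨h, hs⟩
  let T : ι → Finset (Bool × Bool) := fun i =>
    Finset.univ.filter fun x => ∃ᶠ t in 𝓝[>] 0, P i x t
  have hT : ∀ {i x}, x ∈ T i ↔ ∃ᶠ t in 𝓝[>] 0, P i x t := by simp [T]
  have hev : ∀ᶠ t in 𝓝[>] (0 : ℝ), ∀ i x, P i x t → x ∈ T i := by
    rw [Filter.eventually_all]
    intro i
    rw [Filter.eventually_all]
    intro x
    by_cases hx : x ∈ T i
    · exact Filter.Eventually.of_forall fun _ _ => hx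
    · have := hx
      rw [hT, Filter.not_frequently] at this
      exact this.mono fun t ht ht' => absurd ht' ht
  have hpartner : ∀ e > 0, ∀ᶠ t in 𝓝[>] (0 : ℝ), ∀ i j x, P i x t → x ∈ T j →
      ∃ s ∈ Set.Ioo 0 e, coord x.1 (δ j s) = coord x.1 (δ i t) := by
    intro e he
    simp only [Filter.eventually_all]
    intro i j x
    by_cases hx : x ∈ T j
    · obtain ⟨s, ⟨-, hs⟩, hse⟩ := ((hT.1 hx).and_eventually (Ioo_mem_nhdsGT he)).exists
      have hcont : Continuous fun t => excess lo hi x (δ i t) := (continuous_excess x).comp (hδ i)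
      -- The excess of the germ `i` is at most zero at the start, so it soon falls below that of the
      -- germ `j` at `s`. The germ `j`, which also starts at most at zero, attains the same positive
      -- value before `s`.
      have hlt : ∀ᶠ t in 𝓝 (0 : ℝ), excess lo hi x (δ i t) < excess lo hi x (δ j s) :=
        hcont.continuousAt.eventually_lt_const ((excess_nonpos (hδ0 i x.1)).trans_lt hs)
      refine (hlt.filter_mono nhdsWithin_le_nhds).mono fun t ht hPt _ => ?_
      obtain ⟨r, hr, hrt⟩ := intermediate_value_Ioo hse.1.le
        ((continuous_excess (lo := lo) (hi := hi) x).comp (hδ j)).continuousOn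
        ⟨(excess_nonpos (hδ0 j x.1)).trans_lt hPt.2, ht⟩
      exact ⟨r, ⟨hr.1, hr.2.trans hse.2⟩, coord_eq_of_excess_eq hrt⟩
    · exact Filter.Eventually.of_forall fun _ _ h => absurd h hx
  obtain ⟨ε, hε, hεT⟩ := (mem_nhdsGT_iff_exists_Ioo_subset' (zero_lt_one' ℝ)).1 hev
  have hcore : ∀ M : Finset ι, M.Nonempty →
      ∃ i ∈ M, ∃ x ∈ T i, ∀ j ∈ M, j ≠ i → x ∉ T j := by
    intro M hM
    -- Otherwise every line outside `D` through a point of a germ, at a small parameter, carries a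
    -- point of another germ, at a parameter as small as desired. Shrinking the ranges successively
    -- gives endless zigzags.
    by_contra hno
    push Not at hno
    have hnext : ∀ e : Set.Ioc 0 (min ε η), ∃ e' : Set.Ioc 0 (min ε η), ∀ t ∈ Set.Ioo 0 e'.1,
        ∀ i j x, P i x t → x ∈ T j →
          ∃ s ∈ Set.Ioo 0 e.1, coord x.1 (δ j s) = coord x.1 (δ i t) := by
      rintro ⟨e, he⟩
      obtain ⟨e', he', hsub⟩ := (mem_nhdsGT_iff_exists_Ioo_subset' (zero_lt_one' ℝ)).1
        (hpartner e he.1)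
      exact ⟨⟨min e e', lt_min he.1 he', (min_le_left _ _).trans he.2⟩,
        fun t ht => hsub ⟨ht.1, ht.2.trans_le (min_le_right _ _)⟩⟩
    choose next hnext using hnext
    let e : ℕ → Set.Ioc 0 (min ε η) := fun n =>
      n.rec ⟨min ε η, lt_min hε hη, le_rfl⟩ fun _ e => next e
    have he : ∀ n t, t ∈ Set.Ioo 0 (e n).1 → t ∈ Set.Ioo 0 ε ∧ t ∈ Set.Ioo 0 η := fun n t ht =>
      ⟨⟨ht.1, ht.2.trans_le ((e n).2.2.trans (min_le_left _ _))⟩,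
        ⟨ht.1, ht.2.trans_le ((e n).2.2.trans (min_le_right _ _))⟩⟩
    refine hK.false_of_walks hKc hWK hD
      (Z := fun n => {p | p ∉ W ∧ ∃ i ∈ M, ∃ t ∈ Set.Ioo 0 (e n).1, p = δ i t}) ?_ ?_ ?_
    · rintro n _ ⟨h, i, -, t, -, rfl⟩
      exact ⟨hδK i t, h⟩
    · intro n
      obtain ⟨i, hi⟩ := hM
      obtain ⟨t, ht, hte⟩ := ((hδW i).and_eventually (Ioo_mem_nhdsGT (e n).2.1)).exists
      exact ⟨_, ht, i, hi, t, hte, rfl⟩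
    · rintro n _ ⟨-, i, hi, t, ht, rfl⟩ c
      rw [or_iff_not_imp_left]
      intro hlive
      obtain ⟨s, hs⟩ := hP i c t hlive
      have hx : (c, s) ∈ T i := hεT (he (n + 1) t ht).1 i _ hs
      obtain ⟨j, hj, hji, hxj⟩ := hno i hi _ hx
      obtain ⟨r, hr, hrt⟩ := hnext (e n) t ht i j _ hs hxj
      -- A partner in `W` would put the common line into `D`.
      refine ⟨δ j r, ⟨fun hW => hlive ?_, j, hj, r, hr, rfl⟩,
        hdisj j i hji r (he n r hr).2 t (he (n + 1) t ht).2, hrt⟩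
      have := hWD _ hW c
      rwa [line, hrt] at this
  -- There are four sides in all, and `k` bounds from below the number used by each germ.
  have hcard : ∀ k, (∀ i, k ≤ (T i).card) → Fintype.card ι + k ≤ 5 ∨ Fintype.card ι = 0 := by
    intro k hk
    rcases isEmpty_or_nonempty ι with h | h
    · exact Or.inr Fintype.card_eq_zero
    · left
      have h1 := card_add_le_card_biUnion hk hcore Finset.univ Finset.univ_nonempty
      have h2 := Finset.card_le_univ (Finset.univ.biUnion T)
      rw [Fintype.card_prod, Fintype.card_bool] at h2
      rw [Finset.card_univ] at h1
      omega
  constructor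
  · have := hcard 1 fun i => by
      obtain ⟨t, ht, hte⟩ := ((hδW i).and_eventually hev).exists
      -- If both lines were in `D`, they would be connected through `W`, and the point outside `W`
      -- would close a cycle.
      have hlive : ∃ c, line c (δ i t) ∉ D := by
        by_contra hno
        push Not at hno
        refine hK.not_reachable (hδK i t) ((hD _ (hno false) _ (hno true)).mono
          (incidence_mono fun q hq => ⟨hWK hq, ?_⟩))
        rintro rfl
        exact ht hq
      obtain ⟨c, hc⟩ := hlive
      obtain ⟨s, hs⟩ := hP i c t hc
      exact Finset.card_pos.2 ⟨_, hte i _ hs⟩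
    omega
  · intro hboth
    have := hcard 2 fun i => by
      obtain ⟨t, ht, hte⟩ := ((hboth i).and_eventually hev).exists
      obtain ⟨s, hs⟩ := hP i false t (ht false)
      obtain ⟨s', hs'⟩ := hP i true t (ht true)
      exact Finset.one_lt_card.2 ⟨_, hte i _ hs, _, hte i _ hs', by simp⟩
    omega

end Obstruction

/-! ### Stars and crosses with branched ends in basic sets -/

section Obstruction

/-- A compact basic set contains at most four arcs that have only an end point in common. -/
lemma IsBasic.card_rays_le {K : Set (ℝ × ℝ)} (hK : IsBasic K) (hKc : IsCompact K)
    {ι : Type*} [Fintype ι] {γ : ι → ℝ → ℝ × ℝ} (hγ : ∀ i, Continuous (γ i))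
    (hγK : ∀ i t, γ i t ∈ K) {O : ℝ × ℝ} (hO : O ∈ K) (h0 : ∀ i, γ i 0 = O)
    (hne : ∀ i, ∀ t ∈ Set.Ioo (0 : ℝ) 1, γ i t ≠ O)
    (hdisj : ∀ i j, i ≠ j → ∀ t ∈ Set.Ioo (0 : ℝ) 1, ∀ s ∈ Set.Ioo (0 : ℝ) 1, γ i t ≠ γ j s) :
    Fintype.card ι ≤ 4 := by
  have key : ∀ c, (incidence {O}).Reachable (line false O) (line c O) := by
    intro c
    cases c
    · exact SimpleGraph.Reachable.refl _
    · exact (incidence_adj (Set.mem_singleton O) false).reachable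
  -- The box degenerates to the point `O`.
  refine (hK.card_germs_le hKc (Set.singleton_subset_iff.2 hO)
    (D := Set.range fun c => line c O) (lo := fun c => coord c O) (hi := fun c => coord c O)
    ?_ ?_ ?_ hγ hγK ?_ one_pos hdisj ?_).1
  · rintro _ ⟨c, rfl⟩ _ ⟨d, rfl⟩
    exact (key c).symm.trans (key d)
  · rintro _ rfl c
    exact ⟨c, rfl⟩
  · rintro c x ⟨h1, h2⟩
    exact ⟨c, Prod.ext rfl (le_antisymm h1 h2)⟩
  · intro i c
    rw [h0]
    exact ⟨le_rfl, le_rfl⟩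
  · intro i
    refine Filter.Eventually.frequently ?_
    filter_upwards [Ioo_mem_nhdsGT one_pos] with t ht
    exact hne i t ht

/-- The union of the lines through `O` and all lines that can be reached from them in a compact
basic set meets the set in a closed set. -/
lemma IsBasic.isClosed_reachable {K : Set (ℝ × ℝ)} (hK : IsBasic K) (hKc : IsCompact K)
    {O : ℝ × ℝ} (hO : O ∈ K) :
    IsClosed {p ∈ K | (incidence K).Reachable (line false p) (line false O)} := by
  obtain ⟨N, hN⟩ := hK.exists_length_le hKc
  -- Lines are followed for `n` steps from `O`; each step is a projection and a preimage, so
  -- compactness persists. As path lengths are bounded, finitely many steps exhaust the component.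
  let R : ℕ → Set (ℝ × ℝ) := fun n =>
    n.rec {O} fun _ R => {q ∈ K | ∃ c, coord c q ∈ coord c '' R}
  have hR : ∀ n, IsCompact (R n) := by
    intro n
    induction n with
    | zero => exact isCompact_singleton
    | succ n ih =>
      have : R (n + 1) = K ∩ ⋃ c, coord c ⁻¹' (coord c '' R n) := by
        ext q
        simp only [Set.mem_inter_iff, Set.mem_iUnion, Set.mem_preimage]
        rfl
      rw [this]
      exact hKc.inter_right (isClosed_iUnion_of_finite fun c =>
        (ih.image (continuous_coord c)).isClosed.preimage (continuous_coord c))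
  have hRK : ∀ n, R n ⊆ K := by
    rintro (_ | n)
    · exact Set.singleton_subset_iff.2 hO
    · exact fun q hq => hq.1
  have hmono : Monotone R := monotone_nat_of_le_succ fun n q hq =>
    ⟨hRK n hq, false, q, hq, rfl⟩
  have hsub : ∀ {a b : Bool × ℝ} (w : (incidence K).Walk a b), b = line false O →
      ∀ p ∈ K, ∀ c, line c p = a → p ∈ R (w.length + 1) := by
    intro a b w hb
    induction w with
    | nil =>
      intro p hp c h
      rw [hb, line_eq_iff] at h
      exact ⟨hp, c, O, rfl, by rw [h.2, h.1]⟩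
    | cons hadj w ih =>
      intro p hp c h
      obtain ⟨q, hq, d, h1, h2⟩ := hadj
      rw [h1, line_eq_iff] at h
      exact ⟨hp, d, q, ih hb q hq (!d) h2.symm, by rw [← h.2, h.1]⟩
  have hsup : ∀ n, ∀ p ∈ R n, ∀ c, (incidence K).Reachable (line c p) (line false O) := by
    have hline : ∀ p ∈ K, ∀ c d, (incidence K).Reachable (line c p) (line d p) := by
      intro p hp c d
      cases c <;> cases d
      · exact SimpleGraph.Reachable.refl _
      · exact (incidence_adj hp false).reachable
      · exact (incidence_adj hp true).reachable
      · exact SimpleGraph.Reachable.refl _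
    intro n
    induction n with
    | zero =>
      intro p hp c
      have hpO : p = O := hp
      rw [hpO]
      exact hline _ hO _ _
    | succ n ih =>
      rintro p ⟨hp, d, q, hq, h⟩ c
      have h1 := ih q hq d
      rw [line, h] at h1
      exact (hline p hp c d).trans h1
  have : {p ∈ K | (incidence K).Reachable (line false p) (line false O)} = R (N + 1) := by
    ext p
    constructor
    · rintro ⟨hp, hr⟩
      obtain ⟨w, hw⟩ := hr.exists_isPath
      exact hmono (Nat.succ_le_succ (hN w hw)) (hsub w rfl p hp false rfl)
    · exact fun hp => ⟨hRK (N + 1) hp, hsup (N + 1) p hp false⟩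
  rw [this]
  exact (hR (N + 1)).isClosed

/-- The exit parameter is the infimum of the parameters outside `W`; since `W` is closed, the curve
is still in `W` there. -/
lemma exists_exit {X : Type*} [TopologicalSpace X] {W : Set X} (hW : IsClosed W) {γ : ℝ → X}
    (hγ : Continuous γ) (h0 : γ 0 ∈ W) :
    ∃ τ ∈ Set.Icc (0 : ℝ) 1, (∀ t ∈ Set.Icc 0 τ, γ t ∈ W) ∧
      (τ = 1 ∨ ∃ᶠ t in 𝓝[>] (0 : ℝ), γ (τ + t) ∉ W) := by
  by_cases hfull : ∀ t ∈ Set.Icc (0 : ℝ) 1, γ t ∈ W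
  · exact ⟨1, ⟨zero_le_one, le_rfl⟩, hfull, Or.inl rfl⟩
  push Not at hfull
  obtain ⟨t₁, ht₁, ht₁W⟩ := hfull
  let S : Set ℝ := {t | t ∈ Set.Icc (0 : ℝ) 1 ∧ γ t ∉ W}
  have hne : S.Nonempty := ⟨t₁, ht₁, ht₁W⟩
  have hbdd : BddBelow S := ⟨0, fun t ht => ht.1.1⟩
  have hS0 : 0 ≤ sInf S := le_csInf hne fun t ht => ht.1.1
  have hS1 : sInf S ≤ 1 := (csInf_le hbdd ⟨ht₁, ht₁W⟩).trans ht₁.2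
  have hlt : ∀ t ∈ Set.Ico 0 (sInf S), γ t ∈ W := by
    intro t ht
    by_contra h
    exact ht.2.not_ge (csInf_le hbdd ⟨⟨ht.1, ht.2.le.trans hS1⟩, h⟩)
  have hle : ∀ t ∈ Set.Icc 0 (sInf S), γ t ∈ W := by
    rcases hS0.eq_or_lt with h | h
    · rw [← h]
      intro t ht
      rwa [le_antisymm ht.2 ht.1]
    · rw [← closure_Ico h.ne]
      exact closure_minimal (s := Set.Ico 0 (sInf S)) (t := γ ⁻¹' W) hlt (hW.preimage hγ)
  refine ⟨sInf S, ⟨hS0, hS1⟩, hle, Or.inr ?_⟩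
  rw [(nhdsGT_basis (0 : ℝ)).frequently_iff]
  intro ε hε
  obtain ⟨s, hs, hsε⟩ := exists_lt_of_csInf_lt hne (lt_add_of_pos_right (sInf S) hε)
  have h1 : sInf S ≤ s := csInf_le hbdd hs
  have h2 : sInf S ≠ s := fun h => hs.2 (h ▸ hle _ ⟨hS0, le_rfl⟩)
  refine ⟨s - sInf S, ⟨sub_pos.2 (lt_of_le_of_ne h1 h2), by linarith⟩, ?_⟩
  rw [add_sub_cancel]
  exact hs.2

/-- A compact basic set contains no cross with branched ends. -/
lemma IsBasic.false_of_crossBranched {K : Set (ℝ × ℝ)} (hK : IsBasic K) (hKc : IsCompact K)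
    {ι : Type*} [Fintype ι] (hι : Fintype.card ι = 4) {γ : ι ⊕ ι × Bool → ℝ → ℝ × ℝ}
    (hγ : ∀ a, Continuous (γ a)) (hγK : ∀ a t, γ a t ∈ K) {O : ℝ × ℝ}
    (h0 : ∀ i, γ (.inl i) 0 = O) (h1 : ∀ i b, γ (.inr (i, b)) 0 = γ (.inl i) 1)
    (hdisj : ∀ a b, a ≠ b → ∀ t ∈ Set.Ioo (0 : ℝ) 1, ∀ s ∈ Set.Ioo (0 : ℝ) 1, γ a t ≠ γ b s)
    (hend : ∀ i x, ∀ t ∈ Set.Ioo (0 : ℝ) 1, ∀ s ∈ Set.Icc (0 : ℝ) 1,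
      γ (.inr x) t ≠ γ (.inl i) s) : False := by
  classical
  have hne : Nonempty ι := Fintype.card_pos_iff.1 (by omega)
  -- The component is taken in the central cross only, so that the interiors of the branches avoid
  -- `W` even where one of their lines is in `D`.
  let L : Set (ℝ × ℝ) := ⋃ i, γ (.inl i) '' Set.Icc 0 1
  have hLc : IsCompact L := isCompact_iUnion fun i => isCompact_Icc.image (hγ _)
  have hLK : L ⊆ K := by
    refine Set.iUnion_subset fun i => ?_
    rintro _ ⟨t, -, rfl⟩
    exact hγK _ _
  have hL : ∀ i, ∀ t ∈ Set.Icc (0 : ℝ) 1, γ (.inl i) t ∈ L := fun i t ht =>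
    Set.mem_iUnion.2 ⟨i, t, ht, rfl⟩
  have hLb := hK.mono hLc.isClosed hLK
  have hO : O ∈ L := hne.elim fun i => h0 i ▸ hL i 0 ⟨le_rfl, zero_le_one⟩
  let D : Set (Bool × ℝ) := {a | (incidence L).Reachable a (line false O)}
  let W : Set (ℝ × ℝ) := {p ∈ L | line false p ∈ D}
  have hWcl : IsClosed W := hLb.isClosed_reachable hLc hO
  have hDl : ∀ p ∈ L, ∀ c d, line c p ∈ D → line d p ∈ D := by
    intro p hp c d h
    cases c <;> cases d
    · exact h
    · exact (incidence_adj hp true).reachable.trans h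
    · exact (incidence_adj hp false).reachable.trans h
    · exact h
  have hDW : ∀ a ∈ D, (incidence W).Reachable a (line false O) := by
    rintro a ⟨w⟩
    generalize hb : line false O = b at w
    induction w with
    | nil => exact SimpleGraph.Reachable.refl _
    | cons hadj w ih =>
      obtain ⟨p, hp, c, rfl, rfl⟩ := hadj
      have hpD : line (!c) p ∈ D := by
        subst hb
        exact ⟨w⟩
      exact (incidence_adj (S := W) ⟨hp, hDl p hp _ _ hpD⟩ c).reachable.trans (ih hb)
  have hWL : W ⊆ L := fun p hp => hp.1
  have hOW : O ∈ W := ⟨hO, SimpleGraph.Reachable.refl _⟩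
  choose θ hθ hθW hθe using fun i => exists_exit hWcl (hγ (.inl i)) (by rwa [h0 i])
  -- This set is connected, so its projections are intervals consisting of lines in `D`; they serve
  -- as the box.
  let W₀ : Set (ℝ × ℝ) := ⋃ i, γ (.inl i) '' Set.Icc 0 (θ i)
  have hW₀W : W₀ ⊆ W := by
    refine Set.iUnion_subset fun i => ?_
    rintro _ ⟨t, ht, rfl⟩
    exact hθW i t ht
  have hW₀c : IsCompact W₀ := isCompact_iUnion fun i => isCompact_Icc.image (hγ _)
  have hW₀θ : ∀ i, γ (.inl i) (θ i) ∈ W₀ := fun i =>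
    Set.mem_iUnion.2 ⟨i, θ i, ⟨(hθ i).1, le_rfl⟩, rfl⟩
  have hW₀p : IsPreconnected W₀ := isPreconnected_iUnion
    ⟨O, Set.mem_iInter.2 fun i => ⟨0, ⟨le_rfl, (hθ i).1⟩, h0 i⟩⟩
    fun i => isPreconnected_Icc.image _ (hγ _).continuousOn
  have hW₀n : W₀.Nonempty := hne.elim fun i => ⟨_, hW₀θ i⟩
  have hIc : ∀ c, IsCompact (coord c '' W₀) := fun c => hW₀c.image (continuous_coord c)
  have germs : ∀ {κ : Type _} [Fintype κ] (k : κ → ι ⊕ ι × Bool) (_ : Function.Injective k)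
      (θ' : κ → ℝ), (∀ o, 0 ≤ θ' o) → (∀ o, θ' o < 1) → (∀ o, γ (k o) (θ' o) ∈ W₀) →
      (∀ o, ∃ᶠ t in 𝓝[>] 0, γ (k o) (θ' o + t) ∉ W) → Fintype.card κ ≤ 4 ∧
        ((∀ o, ∃ᶠ t in 𝓝[>] 0, ∀ c, line c (γ (k o) (θ' o + t)) ∉ D) → Fintype.card κ ≤ 3) := by
    intro κ _ k hk θ' hθ0 hθ1 hθW₀ hfr
    have hη : ∀ᶠ t in 𝓝[>] (0 : ℝ), ∀ o, θ' o + t < 1 := by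
      rw [Filter.eventually_all]
      intro o
      filter_upwards [Ioo_mem_nhdsGT (sub_pos.2 (hθ1 o))] with t ht
      linarith [ht.2]
    obtain ⟨η, hη1, hη0⟩ := (hη.and self_mem_nhdsWithin).exists
    refine hK.card_germs_le hKc (hWL.trans hLK) (D := D)
      (fun a ha b hb => (hDW a ha).trans (hDW b hb).symm)
      (fun p hp c => hDl p hp.1 _ _ hp.2) (lo := fun c => sInf (coord c '' W₀))
      (hi := fun c => sSup (coord c '' W₀)) ?_ (δ := fun o t => γ (k o) (θ' o + t))
      (fun o => (hγ _).comp (continuous_const_add _)) (fun o t => hγK _ _) ?_ hη0 ?_ hfr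
    · intro c x hx
      obtain ⟨p, hp, rfl⟩ := ((hW₀p.image _ (continuous_coord c).continuousOn).ordConnected.out
        ((hIc c).sInf_mem (hW₀n.image _)) ((hIc c).sSup_mem (hW₀n.image _))) hx
      exact hDl p (hWL (hW₀W hp)) _ _ (hW₀W hp).2
    · intro o c
      simp only [add_zero]
      have : coord c (γ (k o) (θ' o)) ∈ coord c '' W₀ := ⟨_, hθW₀ o, rfl⟩
      exact ⟨csInf_le (hIc c).bddBelow this, le_csSup (hIc c).bddAbove this⟩
    · intro o o' hne t ht s hs
      refine hdisj _ _ (hk.ne hne) _ ⟨?_, ?_⟩ _ ⟨?_, ?_⟩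
      · linarith [hθ0 o, ht.1]
      · linarith [hη1 o, ht.2]
      · linarith [hθ0 o', hs.1]
      · linarith [hη1 o', hs.2]
  have hout : ∀ x, ∃ᶠ t in 𝓝[>] (0 : ℝ), γ (.inr x) (0 + t) ∉ W := by
    intro x
    refine Filter.Eventually.frequently ?_
    filter_upwards [Ioo_mem_nhdsGT one_pos] with t ht hW
    obtain ⟨i, s, hs, h⟩ := Set.mem_iUnion.1 (hWL hW)
    rw [zero_add] at h
    exact hend i x t ht s hs h.symm
  -- If a ray stays in `W` to its end, both branches leave there; together with one germ for each of
  -- the other three rays this makes five.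
  by_cases hfull : ∃ i, θ i = 1
  · obtain ⟨i₀, hi₀⟩ := hfull
    have hb : ∀ i b, θ i = 1 → γ (.inr (i, b)) 0 ∈ W₀ := by
      intro i b h
      rw [h1, ← h]
      exact hW₀θ i
    have := (germs (κ := Option ι)
      (fun o => o.elim (.inr (i₀, true)) fun i => if θ i = 1 then .inr (i, false) else .inl i)
      ?_ (fun o => o.elim 0 fun i => if θ i = 1 then 0 else θ i) ?_ ?_ ?_ ?_).1
    · rw [Fintype.card_option] at this
      omega
    · rintro (_ | i) (_ | j) h
      · rfl
      all_goals
        simp only [Option.elim] at h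
        split_ifs at h <;> cases h <;> rfl
    · rintro (_ | i)
      · exact le_rfl
      · simp only [Option.elim]
        split_ifs
        · exact le_rfl
        · exact (hθ i).1
    · rintro (_ | i)
      · exact one_pos
      · simp only [Option.elim]
        split_ifs with h
        · exact one_pos
        · exact lt_of_le_of_ne (hθ i).2 h
    · rintro (_ | i)
      · exact hb _ _ hi₀
      · simp only [Option.elim]
        split_ifs with h
        · exact hb _ _ h
        · exact hW₀θ i
    · rintro (_ | i)
      · exact hout _
      · simp only [Option.elim]
        split_ifs with h
        · exact hout _
        · exact (hθe i).resolve_left h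
  -- Now all four rays leave `W` inside `L`, where a point outside `W` has neither line in `D`; only
  -- three such germs are allowed.
  · push Not at hfull
    have hfr := fun i => (hθe i).resolve_left (hfull i)
    have hlt : ∀ i, θ i < 1 := fun i => lt_of_le_of_ne (hθ i).2 (hfull i)
    have := (germs (κ := ι) .inl Sum.inl_injective θ (fun i => (hθ i).1) hlt hW₀θ hfr).2 ?_
    · omega
    · intro i
      refine ((hfr i).and_eventually (Ioo_mem_nhdsGT (sub_pos.2 (hlt i)))).mono ?_
      rintro t ⟨ht, ht0, ht1⟩ c hc
      have hmem : γ (.inl i) (θ i + t) ∈ L := hL i _ ⟨by linarith [(hθ i).1], by linarith⟩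
      exact ht ⟨hmem, hDl _ hmem _ _ hc⟩

end Obstruction

/-! ### The obstructions for realized graphs -/

section Obstruction

lemma BasicallyEmbeddable.of_hasSubgraph {K X : Type*} [TopologicalSpace K] [TopologicalSpace X]
    [CompactSpace X] (hK : BasicallyEmbeddable K) (h : HasSubgraphHomeomorphicTo K X) :
    BasicallyEmbeddable X := by
  obtain ⟨φ, hφ, hb⟩ := hK
  obtain ⟨L, -, ⟨e⟩⟩ := h
  have hψ : IsEmbedding (fun x => φ (e.symm x)) :=
    (hφ.comp IsEmbedding.subtypeVal).comp e.symm.isEmbedding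
  refine ⟨_, hψ, hb.mono (isCompact_range hψ.continuous).isClosed ?_⟩
  rintro _ ⟨x, rfl⟩
  exact ⟨_, rfl⟩

lemma isPreconnected_compl_singleton_circle (z : Circle) : IsPreconnected ({z}ᶜ : Set Circle) := by
  obtain ⟨a, rfl⟩ := Circle.exp_surjective z
  have : ({Circle.exp a}ᶜ : Set Circle) = Circle.exp '' Set.Ioo a (a + 2 * Real.pi) := by
    ext w
    constructor
    · intro hw
      obtain ⟨x, rfl⟩ := Circle.exp_surjective w
      obtain ⟨y, hy, hxy⟩ := Circle.periodic_exp.exists_mem_Ioc Real.two_pi_pos x a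
      refine ⟨y, ⟨hy.1, lt_of_le_of_ne hy.2 ?_⟩, hxy.symm⟩
      rintro rfl
      exact hw (hxy.trans (Circle.exp_add_two_pi a))
    · rintro ⟨x, hx, rfl⟩ h
      obtain ⟨m, hm⟩ := Circle.exp_eq_exp.1 h
      have hpi := Real.two_pi_pos
      have h1 : (0 : ℝ) < m := by
        by_contra hle
        nlinarith [hx.1]
      have h2 : (m : ℝ) < 1 := by
        by_contra hle
        nlinarith [hx.2]
      have h3 : 0 < m := by exact_mod_cast h1
      have h4 : m < 1 := by exact_mod_cast h2
      omega
  rw [this]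
  exact isPreconnected_Ioo.image _ Circle.exp.continuous.continuousOn

/-- No point disconnects the circle, so its image would be finite, yet it is connected and has two
points. -/
lemma not_basicallyEmbeddable_circle : ¬ BasicallyEmbeddable Circle := by
  rintro ⟨φ, hφ, hb⟩
  have hfin := hb.finite_of_isPreconnected (isCompact_range hφ.continuous) (by
    rintro _ ⟨z, rfl⟩
    rw [← Set.image_univ, ← Set.image_singleton, ← Set.image_sdiff hφ.injective,
      ← Set.compl_eq_univ_sdiff]
    exact (isPreconnected_compl_singleton_circle z).image _ hφ.continuous.continuousOn)
  have hpre : IsPreconnected (Set.range φ) := by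
    rw [← Set.image_univ]
    exact isPreconnected_univ.image _ hφ.continuous.continuousOn
  refine hpre.infinite_of_nontrivial ⟨_, ⟨1, rfl⟩, _, ⟨Circle.exp Real.pi, rfl⟩, ?_⟩ hfin
  refine hφ.injective.ne fun h => ?_
  have := congrArg (fun z : Circle => (z : ℂ)) h
  norm_num [Circle.coe_exp] at this

variable {V : Type*} {G : SimpleGraph V}

/-- The edge of a realized graph, parametrized by the unit interval and then extended. -/
noncomputable def edgeArc {u v : V} (h : G.Adj u v) (t : ℝ) : Realization G :=
  ⟨edgePoint u v (Set.projIcc 0 1 zero_le_one t),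
    edgePoint_mem_carrier h (Set.projIcc 0 1 zero_le_one t).2⟩

lemma edgeArc_coe {u v : V} (h : G.Adj u v) {t : ℝ} (ht : t ∈ Set.Icc (0 : ℝ) 1) :
    (edgeArc h t : V → ℝ) = edgePoint u v t := by
  change edgePoint u v (Set.projIcc 0 1 zero_le_one t : ℝ) = _
  rw [Set.projIcc_of_mem zero_le_one ht]

lemma continuous_edgeArc {u v : V} (h : G.Adj u v) : Continuous (edgeArc h) :=
  ((continuous_edgePoint u v).comp
    (continuous_subtype_val.comp continuous_projIcc)).subtype_mk _

lemma edgeArc_zero {u v : V} (h : G.Adj u v) : (edgeArc h 0 : V → ℝ) = vertexPoint u := by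
  rw [edgeArc_coe h (by simp), edgePoint_zero]

lemma edgeArc_one {u v : V} (h : G.Adj u v) : (edgeArc h 1 : V → ℝ) = vertexPoint v := by
  rw [edgeArc_coe h (by simp), edgePoint_one]

/-- An interior point of the edge `uv` has a positive coordinate at `v`, which must be an end of any
edge containing the point. -/
lemma eq_or_eq_of_edgeArc_eq {u v u' v' : V} {h : G.Adj u v} {h' : G.Adj u' v'} {t s : ℝ}
    (ht : t ∈ Set.Ioo (0 : ℝ) 1) (hs : s ∈ Set.Icc (0 : ℝ) 1) (e : edgeArc h t = edgeArc h' s) :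
    v = u' ∨ v = v' := by
  by_contra hno
  rw [not_or] at hno
  have := congrFun (congrArg Subtype.val e) v
  rw [edgeArc_coe h ⟨ht.1.le, ht.2.le⟩, edgeArc_coe h' hs, edgePoint_apply_right h.ne,
    edgePoint_apply_of_ne hno.1 hno.2] at this
  exact ht.1.ne' this

lemma BasicallyEmbeddable.card_le_of_adj [Finite V] (hG : BasicallyEmbeddable (Realization G))
    {ι : Type*} [Fintype ι] {O : V} {P : ι → V} (hP : Function.Injective P)
    (h : ∀ i, G.Adj O (P i)) : Fintype.card ι ≤ 4 := by
  obtain ⟨φ, hφ, hb⟩ := hG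
  rcases isEmpty_or_nonempty ι with hι | ⟨⟨i₀⟩⟩
  · rw [Fintype.card_eq_zero]
    omega
  refine hb.card_rays_le (isCompact_range hφ.continuous) (γ := fun i t => φ (edgeArc (h i) t))
    (fun i => hφ.continuous.comp (continuous_edgeArc _)) (fun i t => ⟨_, rfl⟩)
    (O := φ (edgeArc (h i₀) 0)) ⟨_, rfl⟩ ?_ ?_ ?_
  · intro i
    refine congrArg φ (Subtype.ext ?_)
    rw [edgeArc_zero, edgeArc_zero]
  · intro i t ht heq
    have := congrFun (congrArg Subtype.val (hφ.injective heq)) (P i)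
    rw [edgeArc_coe _ ⟨ht.1.le, ht.2.le⟩, edgeArc_zero, edgePoint_apply_right (h i).ne,
      vertexPoint_of_ne (h i).ne'] at this
    exact ht.1.ne' this
  · intro i j hij t ht s hs heq
    rcases eq_or_eq_of_edgeArc_eq ht ⟨hs.1.le, hs.2.le⟩ (hφ.injective heq) with h' | h'
    · exact (h i).ne' h'
    · exact hij (hP h')

lemma BasicallyEmbeddable.false_of_adj [Finite V] (hG : BasicallyEmbeddable (Realization G))
    {O : V} {P : Fin 4 → V} {Q : Fin 4 × Bool → V} (hP : Function.Injective P)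
    (hQ : Function.Injective Q) (hOP : ∀ i, G.Adj O (P i)) (hPQ : ∀ x, G.Adj (P x.1) (Q x))
    (hQO : ∀ x, Q x ≠ O) (hQP : ∀ x i, Q x ≠ P i) : False := by
  obtain ⟨φ, hφ, hb⟩ := hG
  let arc : Fin 4 ⊕ Fin 4 × Bool → ℝ → Realization G :=
    Sum.elim (fun i => edgeArc (hOP i)) fun x => edgeArc (hPQ x)
  refine hb.false_of_crossBranched (isCompact_range hφ.continuous) (Fintype.card_fin 4)
    (γ := fun a t => φ (arc a t)) ?_ (fun a t => ⟨_, rfl⟩) (O := φ (edgeArc (hOP 0) 0))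
    ?_ ?_ ?_ ?_
  · rintro (i | x)
    · exact hφ.continuous.comp (continuous_edgeArc (hOP i))
    · exact hφ.continuous.comp (continuous_edgeArc (hPQ x))
  · intro i
    refine congrArg φ (Subtype.ext ?_)
    exact (edgeArc_zero (hOP i)).trans (edgeArc_zero (hOP 0)).symm
  · intro i b
    refine congrArg φ (Subtype.ext ?_)
    exact (edgeArc_zero (hPQ (i, b))).trans (edgeArc_one (hOP i)).symm
  · rintro a b hab t ht s hs heq
    have ht' := Set.Ioo_subset_Icc_self ht
    have hs' := Set.Ioo_subset_Icc_self hs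
    have e := hφ.injective heq
    rcases a with i | x <;> rcases b with j | y
    · rcases eq_or_eq_of_edgeArc_eq (h := hOP i) (h' := hOP j) ht hs' e with h | h
      · exact (hOP i).ne' h
      · exact hab (congrArg _ (hP h))
    · rcases eq_or_eq_of_edgeArc_eq (h := hPQ y) (h' := hOP i) hs ht' e.symm with h | h
      · exact hQO _ h
      · exact hQP _ _ h
    · rcases eq_or_eq_of_edgeArc_eq (h := hPQ x) (h' := hOP j) ht hs' e with h | h
      · exact hQO _ h
      · exact hQP _ _ h
    · rcases eq_or_eq_of_edgeArc_eq (h := hPQ x) (h' := hPQ y) ht hs' e with h | h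
      · exact hQP _ _ h
      · exact hab (congrArg _ (hQ h))
  · intro i x t ht s hs heq
    rcases eq_or_eq_of_edgeArc_eq (h := hPQ x) (h' := hOP i) ht hs (hφ.injective heq) with h | h
    · exact hQO _ h
    · exact hQP _ _ h

namespace FinGraph

lemma not_basicallyEmbeddable_starGraph_five : ¬ BasicallyEmbeddable (starGraph 5).Space := by
  intro h
  have := h.card_le_of_adj (O := .inl ()) (P := fun i : Fin 5 => .inr ⟨(), i⟩)
    (fun i j hij => by simpa using hij) (fun i => rfl)
  simp at this

lemma exists_adj_attach (A : FinGraph) {p : A.V → ℕ} {ι : Type*} {x : ι → A.V}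
    (hx : Function.Injective x) (hp : ∀ i, p (x i) = 2) :
    ∃ Q : ι × Bool → (A.attach p).V, Function.Injective Q ∧
      (∀ y, (A.attach p).graph.Adj (.inl (x y.1)) (Q y)) ∧ ∀ y v, Q y ≠ .inl v := by
  refine ⟨fun y => .inr ⟨x y.1, Fin.cast (hp y.1).symm (if y.2 then 1 else 0)⟩, ?_,
    fun y => rfl, fun y v => Sum.inr_ne_inl⟩
  rintro ⟨i, b⟩ ⟨j, c⟩ h
  have h1 := Sum.inr_injective h
  obtain rfl : i = j := hx (congrArg Sigma.fst h1)
  have h2 := congrArg Fin.val (eq_of_heq (Sigma.mk.inj h1).2)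
  cases b <;> cases c <;> first | rfl | simp at h2

lemma not_basicallyEmbeddable_crossBranched : ¬ BasicallyEmbeddable crossBranched.Space := by
  classical
  intro h
  obtain ⟨Q, hQ, hadj, hne⟩ := exists_adj_attach (starGraph 4)
    (p := fun v => if (starGraph 4).deg v = 1 then 2 else 0)
    (x := fun i : Fin 4 => .inr ⟨(), i⟩) (fun i j hij => by simpa using hij)
    (fun i => if_pos (deg_attach_inr point _ _))
  have hP : Function.Injective fun i : Fin 4 =>
      (Sum.inl (Sum.inr ⟨(), i⟩) : ((starGraph 4).attach
        fun v => if (starGraph 4).deg v = 1 then 2 else 0).V) := fun i j hij => by simpa using hij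
  exact BasicallyEmbeddable.false_of_adj (G := crossBranched.graph) h (O := .inl (.inl ())) hP hQ
    (fun i => rfl) hadj (fun x => hne x _) fun x i => hne x _

end FinGraph

end Obstruction

end BasicEmbedding

theorem mainTheorem1 (K : Type*) [TopologicalSpace K]
    (hK : BasicEmbedding.IsFiniteGraph K) :
    List.TFAE [
      BasicEmbedding.BasicallyEmbeddable K,
      ¬ BasicEmbedding.HasSubgraphHomeomorphicTo K Circle ∧
        ¬ BasicEmbedding.HasSubgraphHomeomorphicTo K (BasicEmbedding.FinGraph.starGraph 5).Space ∧
        ¬ BasicEmbedding.HasSubgraphHomeomorphicTo K BasicEmbedding.FinGraph.crossBranched.Space,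
      ∃ n : ℕ, 1 ≤ n ∧ BasicEmbedding.IsContainedIn K (BasicEmbedding.FinGraph.R n).Space] := by
  have := hK.compactSpace
  tfae_have 1 → 2 := fun h =>
    ⟨fun h' => BasicEmbedding.not_basicallyEmbeddable_circle (h.of_hasSubgraph h'),
      fun h' => BasicEmbedding.FinGraph.not_basicallyEmbeddable_starGraph_five
        (h.of_hasSubgraph h'),
      fun h' => BasicEmbedding.FinGraph.not_basicallyEmbeddable_crossBranched
        (h.of_hasSubgraph h')⟩
  tfae_have 2 → 3 := fun h =>
    BasicEmbedding.isContainedIn_R_of_not_hasSubgraph hK h.1 h.2.1 h.2.2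
  tfae_have 3 → 1 := fun ⟨_, hn, h⟩ =>
    BasicEmbedding.basicallyEmbeddable_of_isContainedIn_R hn h
  tfae_finish
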